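/- Let $D=(0,1)$, let $(\cdot,\cdot)_{0,D}$ and $\|\cdot\|_{0,D}$ be the inner product and norm of $L^2(D)$ (real-valued functions), let $H^s(D)$, $s\in\mathbb N_0$, be the usual Sobolev spaces with norms $\|g\|_{s,D}=\big(\sum_{\ell=0}^s\|\partial^\ell g\|_{0,D}^2\big)^{1/2}$, and let $H^1_0(D)$ be the space of functions in $H^1(D)$ that vanish at $0$ and $1$. With $\lambda_k=k\pi$ and $\varepsilon_k(z)=\sqrt2\,\sin(\lambda_k z)$ for $k\ge1$, let $\dot{\bf H}^m(D)=\{v\in L^2(D):\sum_{k\ge1}\lambda_k^{2m}(v,\varepsilon_k)_{0,D}^2<\infty\}$ for $m\in\mathbb N_0$, and $$\|v\|_{-1,D}=\sup\Big\{\tfrac{(v,\varphi)_{0,D}}{\|\varphi\|_{1,D}}:\ \varphi\in\dot{\bf H}^1(D),\ \varphi\neq0\Big\},\qquad v\in L^2(D).$$ Let $\mu\in\mathbb R$ be such that $(\kappa-1)^2\pi^2\le\mu<\kappa^2\pi^2$ for some integer $\kappa\ge1$, and let $r\in\{2,3\}$. For each $f\in L^2(D)$ there is exactly one $\widetilde v_B=\widetilde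 T_Bf\in\dot{\bf H}^4(D)\subset H^4(D)$ with $$\widetilde\Lambda_B\widetilde v_B:=\partial^4\widetilde v_B+\mu\,\partial^2\widetilde v_B+\mu^2\,\widetilde v_B=f\quad\text{in } D .$$ Let $0=x_0<x_1<\dots<x_N=1$ be a partition of $D$ and $h=\max_i(x_{i}-x_{i-1})$. Let $M_h^r$ be a finite element space over it, that is, a linear space of functions in $H^2(D)\cap H^1_0(D)$ which are polynomials of degree at most $r$ on each $(x_{i-1},x_i)$, and which contains all such functions that belong to $H^r(D)$ (for $r=2$ this is the space of all such functions in $H^2(D)\cap H_0^1(D)$; for $r=3$ it may be any space between the $C^2$ and the $C^1$ piecewise cubics that vanish at $0$ and $1$, both included). For each $f\in L^2(D)$ there is exactly one $\widetilde v_{B,h}=\widetilde T_{B,h}f\in M_h^r$ with $$(\partial^2\widetilde v_{B,h},\partial^2\chi)_{0,D}+\mu\,(\partial^2\widetilde v_{B,h},\chi)_{0,D}+\mu^2\,(\widetilde v_{B,h},\chi)_{0,D}=(f,\chi)_{0,D}\qquad\forall\,\chi\in M_h^r .$$ Moreover, there is a constant $C>0$, depending only on $\mu$ and $r$ (in particular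 independent of $f$, of the partition and its $h$, and of the space $M_h^r$), such that for all $f\in L^2(D)$ $$\|\widetilde T_Bf-\widetilde T_{B,h}f\|_{0,D}\le C\,h^4\,\|f\|_{0,D}\quad\text{and}\quad\|\widetilde T_Bf-\widetilde T_{B,h}f\|_{0,D}\le C\,h^3\,\|f\|_{-1,D}\qquad\text{if } r=3,$$ $$\|\widetilde T_Bf-\widetilde T_{B,h}f\|_{0,D}\le C\,h^2\,\|f\|_{-1,D}\qquad\text{if } r=2.$$ -/

import Mathlib

open MeasureTheory Set
open scoped ContDiff Polynomial InnerProductSpace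

noncomputable section

namespace CHC

/-- Lebesgue measure on the interval `D = (0,1)`. -/
abbrev volD : Measure ℝ := volume.restrict (Ioo (0 : ℝ) 1)

/-- The real Hilbert space `L²(D)`; its norm and inner product are `‖·‖_{0,D}` and `(·,·)_{0,D}`. -/
abbrev L2D : Type := Lp ℝ 2 volD

/-- `w` is the weak (generalized) derivative of order `k` of `u` on `D`. -/
def HasWeakDeriv (k : ℕ) (u w : L2D) : Prop :=
  ∀ φ : ℝ → ℝ, ContDiff ℝ ∞ φ → HasCompactSupport φ → tsupport φ ⊆ Ioo (0 : ℝ) 1 →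
    ∫ x, u x * iteratedDeriv k φ x ∂volD = (-1 : ℝ) ^ k * ∫ x, w x * φ x ∂volD

theorem integrable_mul_test (u : L2D) {ψ : ℝ → ℝ} (hc : Continuous ψ) :
    Integrable (fun x => u x * ψ x) volD := by
  have h1 : Integrable (fun x => u x) volD := (Lp.memLp u).integrable one_le_two
  have h2 : IntegrableOn (fun x => u x) (Ioo (0 : ℝ) 1) volume := h1
  rw [← integrableOn_Icc_iff_integrableOn_Ioo] at h2
  have h3 := h2.mul_continuousOn hc.continuousOn isCompact_Icc
  exact h3.mono_set Ioo_subset_Icc_self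

theorem HasWeakDeriv.add {k : ℕ} {u u' w w' : L2D} (h : HasWeakDeriv k u w)
    (h' : HasWeakDeriv k u' w') : HasWeakDeriv k (u + u') (w + w') := by
  intro φ h1 h2 h3
  have hk : Continuous (iteratedDeriv k φ) := h1.continuous_iteratedDeriv k (by exact_mod_cast le_top)
  have e1 : ∫ x, (u + u') x * iteratedDeriv k φ x ∂volD
      = ∫ x, (u x * iteratedDeriv k φ x + u' x * iteratedDeriv k φ x) ∂volD := by
    apply integral_congr_ae
    filter_upwards [Lp.coeFn_add u u'] with x hx
    simp only [hx, Pi.add_apply, add_mul]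
  have e2 : ∫ x, (w + w') x * φ x ∂volD = ∫ x, (w x * φ x + w' x * φ x) ∂volD := by
    apply integral_congr_ae
    filter_upwards [Lp.coeFn_add w w'] with x hx
    simp only [hx, Pi.add_apply, add_mul]
  rw [e1, e2, integral_add (integrable_mul_test u hk) (integrable_mul_test u' hk),
    integral_add (integrable_mul_test w h1.continuous) (integrable_mul_test w' h1.continuous),
    h φ h1 h2 h3, h' φ h1 h2 h3, mul_add]

theorem HasWeakDeriv.smul {k : ℕ} {u w : L2D} (c : ℝ) (h : HasWeakDeriv k u w) :
    HasWeakDeriv k (c • u) (c • w) := by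
  intro φ h1 h2 h3
  have e1 : ∫ x, (c • u) x * iteratedDeriv k φ x ∂volD
      = ∫ x, c * (u x * iteratedDeriv k φ x) ∂volD := by
    apply integral_congr_ae
    filter_upwards [Lp.coeFn_smul c u] with x hx
    simp only [hx, Pi.smul_apply, smul_eq_mul, mul_assoc]
  have e2 : ∫ x, (c • w) x * φ x ∂volD = ∫ x, c * (w x * φ x) ∂volD := by
    apply integral_congr_ae
    filter_upwards [Lp.coeFn_smul c w] with x hx
    simp only [hx, Pi.smul_apply, smul_eq_mul, mul_assoc]
  rw [e1, e2, integral_const_mul, integral_const_mul, h φ h1 h2 h3]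
  ring

theorem HasWeakDeriv.zero (k : ℕ) : HasWeakDeriv k 0 0 := by
  intro φ _ _ _
  have e (ψ : ℝ → ℝ) : ∫ x, (0 : L2D) x * ψ x ∂volD = 0 := by
    rw [← integral_zero ℝ ℝ (μ := volD)]
    apply integral_congr_ae
    filter_upwards [Lp.coeFn_zero ℝ 2 volD] with x hx
    rw [hx, Pi.zero_apply, zero_mul]
  rw [e, e, mul_zero]

theorem HasWeakDeriv.unique {k : ℕ} {u w w' : L2D} (h : HasWeakDeriv k u w)
    (h' : HasWeakDeriv k u w') : w = w' := by
  have hi (v : L2D) : LocallyIntegrableOn (fun x => v x) (Ioo (0 : ℝ) 1) volume :=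
    IntegrableOn.locallyIntegrableOn ((Lp.memLp v).integrable one_le_two)
  have key := isOpen_Ioo.ae_eq_zero_of_integral_contDiff_smul_eq_zero
    ((hi w).sub (hi w')) (fun g g1 g2 g3 => by
      have hs : Function.support (fun x => g x • ((fun x => w x) - fun x => w' x) x)
          ⊆ Ioo (0 : ℝ) 1 := fun x hx => g3 (subset_tsupport g (by
            intro h0
            apply hx
            simp [h0]))
      rw [← setIntegral_eq_integral_of_forall_compl_eq_zero
        (s := Ioo (0 : ℝ) 1) (fun x hx => by
          by_contra hne
          exact hx (hs hne))]
      have e := (h g g1 g2 g3).symm.trans (h' g g1 g2 g3)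
      have e' := mul_left_cancel₀ (pow_ne_zero k (by norm_num : (-1 : ℝ) ≠ 0)) e
      have e'' := integral_sub (integrable_mul_test w g1.continuous)
        (integrable_mul_test w' g1.continuous)
      rw [e', sub_self] at e''
      refine Eq.trans ?_ e''
      apply integral_congr_ae
      filter_upwards with x
      simp only [Pi.sub_apply, smul_eq_mul]
      ring)
  apply Lp.ext
  rw [Filter.EventuallyEq, ae_restrict_iff' measurableSet_Ioo]
  filter_upwards [key] with x hx hxD
  exact sub_eq_zero.mp (hx hxD)

open Classical in
/-- The weak derivative `∂^k u ∈ L²(D)`, which is unique when it exists (and `0` otherwise). -/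
def weakDeriv (k : ℕ) (u : L2D) : L2D :=
  if h : ∃ w, HasWeakDeriv k u w then h.choose else 0

theorem HasWeakDeriv.weakDeriv_eq {k : ℕ} {u w : L2D} (h : HasWeakDeriv k u w) :
    weakDeriv k u = w := by
  have hex : ∃ w, HasWeakDeriv k u w := ⟨w, h⟩
  rw [weakDeriv, dif_pos hex]
  exact hex.choose_spec.unique h

/-- The Sobolev space `H^m(D)`. -/
def sobolev (m : ℕ) : Submodule ℝ L2D where
  carrier := {u | ∀ l ≤ m, ∃ w, HasWeakDeriv l u w}
  add_mem' := by
    intro u u' h h' l hl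
    obtain ⟨w, hw⟩ := h l hl
    obtain ⟨w', hw'⟩ := h' l hl
    exact ⟨w + w', hw.add hw'⟩
  zero_mem' := fun l _ => ⟨0, HasWeakDeriv.zero l⟩
  smul_mem' := by
    intro c u h l hl
    obtain ⟨w, hw⟩ := h l hl
    exact ⟨c • w, hw.smul c⟩

/-- The Sobolev norm `‖u‖_{m,D} = (∑_{l=0}^m ‖∂^l u‖²)^{1/2}` for `u ∈ H^m(D)`. -/
def sobolevNorm (m : ℕ) (u : L2D) : ℝ :=
  Real.sqrt (∑ l ∈ Finset.range (m + 1), ‖weakDeriv l u‖ ^ 2)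

/-- The space of the `u ∈ L²(D)` that have a continuous representative on `[0,1]`
vanishing at both endpoints. -/
def zeroTrace : Submodule ℝ L2D where
  carrier := {u | ∃ g : ℝ → ℝ, ContinuousOn g (Icc 0 1) ∧ (u : ℝ → ℝ) =ᵐ[volD] g ∧
    g 0 = 0 ∧ g 1 = 0}
  add_mem' := by
    rintro u u' ⟨g, hg, hu, h0, h1⟩ ⟨g', hg', hu', h0', h1'⟩
    exact ⟨g + g', hg.add hg', (Lp.coeFn_add u u').trans (hu.add hu'), by simp [h0, h0'],
      by simp [h1, h1']⟩
  zero_mem' := ⟨0, continuousOn_const, Lp.coeFn_zero ℝ 2 volD, rfl, rfl⟩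
  smul_mem' := by
    rintro c u ⟨g, hg, hu, h0, h1⟩
    exact ⟨c • g, hg.const_smul c, (Lp.coeFn_smul c u).trans (hu.const_smul c), by simp [h0],
      by simp [h1]⟩

/-- `H^1_0(D)`: the functions in `H^1(D)` that vanish at the endpoints in the sense of trace
(in one dimension, the trace is the endpoint value of the continuous representative). -/
def H10 : Submodule ℝ L2D := sobolev 1 ⊓ zeroTrace

/-- `λ_k = k π`. -/
def lam (k : ℕ) : ℝ := k * Real.pi

/-- `ε_k(z) = √2 sin(λ_k z)`. -/
def eps (k : ℕ) (z : ℝ) : ℝ := Real.sqrt 2 * Real.sin (lam k * z)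

/-- The sine coefficient `(v, ε_k)_{0,D}`. -/
def sineCoeff (v : L2D) (k : ℕ) : ℝ := ∫ x, v x * eps k x ∂volD

/-- The space `Ḣ^m(D)` of the `v ∈ L²(D)` with `∑_{k ≥ 1} λ_k^{2m} (v, ε_k)² < ∞`. -/
def dotH (m : ℕ) : Set L2D :=
  {v | Summable fun k : ℕ => lam (k + 1) ^ (2 * m) * sineCoeff v (k + 1) ^ 2}

/-- The negative norm
`‖v‖_{-m,D} = sup {(v, φ)_{0,D} / ‖φ‖_{m,D} : φ ∈ Ḣ^m(D), φ ≠ 0}` for `v ∈ L²(D)`. -/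
def negNorm (m : ℕ) (v : L2D) : ℝ :=
  sSup {t | ∃ φ ∈ dotH m, φ ≠ 0 ∧ t = ⟪v, φ⟫_ℝ / sobolevNorm m φ}

/-- `v ∈ Ḣ⁴(D)` solves the boundary value problem `∂⁴v + μ ∂²v + μ² v = f` in `D`. -/
def IsSolution (μ : ℝ) (f v : L2D) : Prop :=
  v ∈ sobolev 4 ∧ v ∈ dotH 4 ∧ weakDeriv 4 v + μ • weakDeriv 2 v + μ ^ 2 • v = f

/-- A partition `0 = x_0 < x_1 < ⋯ < x_N = 1` of `D`. -/
structure Mesh where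
  N : ℕ
  node : Fin (N + 1) → ℝ
  strictMono : StrictMono node
  node_first : node 0 = 0
  node_last : node (Fin.last N) = 1

/-- The maximum mesh-length `h = max_i (x_{i+1} - x_i)`. -/
def Mesh.size (P : Mesh) : ℝ := ⨆ i : Fin P.N, (P.node i.succ - P.node i.castSucc)

/-- The functions that are polynomials of degree at most `r` on each interval of the partition. -/
def piecewisePoly (P : Mesh) (r : ℕ) : Submodule ℝ L2D where
  carrier := {u | ∀ i : Fin P.N, ∃ p : ℝ[X], p.natDegree ≤ r ∧
    ∀ᵐ x ∂volD, x ∈ Ioo (P.node i.castSucc) (P.node i.succ) → u x = p.eval x}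
  add_mem' := by
    intro u u' h h' i
    obtain ⟨p, hp, hu⟩ := h i
    obtain ⟨q, hq, hu'⟩ := h' i
    refine ⟨p + q, Polynomial.natDegree_add_le_of_degree_le hp hq, ?_⟩
    filter_upwards [hu, hu', Lp.coeFn_add u u'] with x h1 h2 h3 hx
    rw [h3, Pi.add_apply, h1 hx, h2 hx, Polynomial.eval_add]
  zero_mem' := by
    intro i
    refine ⟨0, by simp, ?_⟩
    filter_upwards [Lp.coeFn_zero ℝ 2 volD] with x h1 hx
    rw [h1, Pi.zero_apply, Polynomial.eval_zero]
  smul_mem' := by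
    intro c u h i
    obtain ⟨p, hp, hu⟩ := h i
    refine ⟨c • p, (Polynomial.natDegree_smul_le c p).trans hp, ?_⟩
    filter_upwards [hu, Lp.coeFn_smul c u] with x h1 h2 hx
    rw [h2, Pi.smul_apply, h1 hx, Polynomial.eval_smul]

/-- The splines of degree at most `r` over the partition `P` that belong to
`H^s(D) ∩ H^1_0(D)`. -/
def splineSpace (P : Mesh) (r s : ℕ) : Submodule ℝ L2D :=
  sobolev s ⊓ H10 ⊓ piecewisePoly P r

/-- A finite element space `M_h^r ⊂ H²(D) ∩ H^1_0(D)` over the partition `P`: its elements are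
piecewise polynomials of degree at most `r`, and it contains the splines of degree at most `r`
and maximal smoothness (`H^r`, i.e. `C^{r-1}`) that vanish at the endpoints. The full space of
`H²` splines, and the splines that are `C²` at some nodes only, are of this kind. -/
def IsFESpace (P : Mesh) (r : ℕ) (M : Submodule ℝ L2D) : Prop :=
  splineSpace P r r ≤ M ∧ M ≤ splineSpace P r 2

/-- `vh ∈ M` is the finite element approximation: `Λ̃_{B,h} vh = P_h f`, that is,
`(∂²vh, ∂²χ) + μ (∂²vh, χ) + μ² (vh, χ) = (f, χ)` for all `χ ∈ M`. -/
def IsFESolution (μ : ℝ) (M : Submodule ℝ L2D) (f vh : L2D) : Prop :=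
  vh ∈ M ∧ ∀ χ ∈ M, ⟪weakDeriv 2 vh, weakDeriv 2 χ⟫_ℝ + μ * ⟪weakDeriv 2 vh, χ⟫_ℝ
    + μ ^ 2 * ⟪vh, χ⟫_ℝ = ⟪f, χ⟫_ℝ

end CHC

end

open MeasureTheory Set
open scoped ContDiff Polynomial InnerProductSpace

noncomputable section

namespace CHC

/-! Let `A = green` be the inverse of `-∂²` with Dirichlet conditions, a bounded symmetric operator
on `L²(D)` with range `H² ∩ H¹₀`. The problem is moved onto second derivatives. A solution is `v =
A²y` with `S y = f`, where `S = 1 - μA + μ²A²` is `symbolOp μ`. A discrete solution is `v_h = A a'`,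
where `a'` lies in `V = secondDerivs M` and satisfies `(S a', b) = (A f, b)` for all `b ∈ V`. Since
`‖u - μAu‖² ≥ 0`, `S` is coercive on `L²(D)` with constant `1/2`, so Lax–Milgram solves both
problems (`symbolOp_coercive`, `existsUnique_isSolution`, `existsUnique_isFESolution`).

`S` commutes with `A`, so `a = Ay` satisfies `S a = A f`. Thus `e = a - a'` has `S e` orthogonal to
`V`, and the error is `v - v_h = A e`. Céa's argument bounds `‖e‖` by the distance from `Ay` to `V`
(`norm_le_of_galerkin`); duality gains a further factor in `‖A e‖` (`norm_green_le_of_galerkin`).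

The powers of `h` come from approximating `Ay`. For `r = 2`, `V` contains the piecewise constants,
with error `h‖∂Ay‖`. For `r = 3`, it contains the primitives of piecewise constants, and the error
is at most both `h‖∂Ay‖` and `h²‖y‖` (`exists_approx_of_eq_two`, `exists_approx_of_eq_three`).
Testing `S y = f` with `Ay` gives `‖∂Ay‖ ≤ C‖f‖₋₁` (`norm_gradOp_le_negNorm`), and coercivity gives
`‖y‖ ≤ 2‖f‖`. The rates are then the products `h²·h²`, `h²·h` and `h·h`. -/

/-! ### Integrals over `D` and `L²` classes of continuous functions -/

theorem intervalIntegral_volD (f : ℝ → ℝ) {a b : ℝ} (ha : a ∈ Icc (0 : ℝ) 1)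
    (hb : b ∈ Icc (0 : ℝ) 1) : ∫ t in a..b, f t ∂volD = ∫ t in a..b, f t := by
  have key : ∀ a ∈ Icc (0 : ℝ) 1, ∀ b ∈ Icc (0 : ℝ) 1, a ≤ b →
      ∫ t in a..b, f t ∂volD = ∫ t in a..b, f t := by
    intro a ha b hb hab
    rw [intervalIntegral.integral_of_le hab, intervalIntegral.integral_of_le hab,
      integral_Ioc_eq_integral_Ioo, integral_Ioc_eq_integral_Ioo,
      Measure.restrict_restrict measurableSet_Ioo,
      inter_eq_left.mpr (Ioo_subset_Ioo ha.1 hb.2)]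
  rcases le_total a b with h | h
  · exact key a ha b hb h
  · rw [intervalIntegral.integral_symm, key b hb a ha h, ← intervalIntegral.integral_symm]

theorem integral_volD (f : ℝ → ℝ) : ∫ t, f t ∂volD = ∫ t in (0 : ℝ)..1, f t := by
  rw [intervalIntegral.integral_of_le zero_le_one, integral_Ioc_eq_integral_Ioo]

theorem integrable_L2D (u : L2D) : Integrable (fun x => u x) volD :=
  (Lp.memLp u).integrable one_le_two

theorem inner_L2D (u v : L2D) : ⟪u, v⟫_ℝ = ∫ x, u x * v x ∂volD := by
  rw [L2.inner_def]
  refine integral_congr_ae (Filter.Eventually.of_forall fun x => ?_)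
  simp [mul_comm]

theorem intervalIntegrable_L2D (u : L2D) : IntervalIntegrable (fun x => u x) volume 0 1 := by
  rw [intervalIntegrable_iff_integrableOn_Ioo_of_le zero_le_one]
  exact integrable_L2D u

theorem memLp_continuousMap (g : C(ℝ, ℝ)) : MemLp g 2 volD := by
  obtain ⟨C, hC⟩ := (isCompact_Icc (a := (0 : ℝ)) (b := 1)).exists_bound_of_continuousOn
    g.continuous.continuousOn
  refine MemLp.of_bound g.continuous.aestronglyMeasurable C ?_
  rw [ae_restrict_iff' measurableSet_Ioo]
  exact Filter.Eventually.of_forall fun x hx => hC x (Ioo_subset_Icc_self hx)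

/-- The class in `L²(D)` of a continuous function. -/
def toL2 : C(ℝ, ℝ) →ₗ[ℝ] L2D where
  toFun g := (memLp_continuousMap g).toLp g
  map_add' _ _ := rfl
  map_smul' _ _ := rfl

theorem coeFn_toL2 (g : C(ℝ, ℝ)) : (toL2 g : ℝ → ℝ) =ᵐ[volD] g :=
  (memLp_continuousMap g).coeFn_toLp

theorem inner_toL2 (u : L2D) (g : C(ℝ, ℝ)) : ⟪u, toL2 g⟫_ℝ = ∫ x, u x * g x ∂volD := by
  rw [inner_L2D]
  refine integral_congr_ae ?_
  filter_upwards [coeFn_toL2 g] with x hx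
  rw [hx]

theorem inner_toL2_toL2 (f g : C(ℝ, ℝ)) :
    ⟪toL2 f, toL2 g⟫_ℝ = ∫ x in (0 : ℝ)..1, f x * g x := by
  rw [inner_toL2, ← integral_volD]
  refine integral_congr_ae ?_
  filter_upwards [coeFn_toL2 f] with x hx
  rw [hx]

theorem eqOn_of_ae_eq_volD {f g : ℝ → ℝ} (h : f =ᵐ[volD] g) (hf : ContinuousOn f (Icc 0 1))
    (hg : ContinuousOn g (Icc 0 1)) : EqOn f g (Icc 0 1) := by
  refine Measure.eqOn_Icc_of_ae_eq volume zero_ne_one ?_ hf hg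
  rwa [← restrict_Ioo_eq_restrict_Icc]

/-- The constant function `1`. -/
def one2 : L2D := toL2 1

theorem inner_one2 (u : L2D) : ⟪one2, u⟫_ℝ = ∫ x, u x ∂volD := by
  rw [real_inner_comm, one2, inner_toL2]
  simp

theorem norm_one2 : ‖one2‖ = 1 := by
  have h : ⟪one2, one2⟫_ℝ = 1 := by
    rw [one2, inner_toL2_toL2]
    simp
  rw [real_inner_self_eq_norm_sq] at h
  exact (pow_eq_one_iff_of_nonneg (norm_nonneg _) two_ne_zero).mp h

/-! ### Primitives and the Volterra operator -/

/-- The primitive of `u` that vanishes at `0`. -/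
def prim (u : L2D) : C(ℝ, ℝ) where
  toFun x := ∫ t in (0 : ℝ)..x, u t ∂volD
  continuous_toFun := (integrable_L2D u).continuous_primitive 0

theorem prim_apply (u : L2D) {x : ℝ} (hx : x ∈ Icc (0 : ℝ) 1) :
    prim u x = ∫ t in (0 : ℝ)..x, u t :=
  intervalIntegral_volD _ (by simp) hx

theorem prim_zero (u : L2D) : prim u 0 = 0 := intervalIntegral.integral_same

theorem prim_one (u : L2D) : prim u 1 = ⟪one2, u⟫_ℝ := by
  rw [prim_apply u (by simp), inner_one2, integral_volD]

theorem prim_add (u v : L2D) : prim (u + v) = prim u + prim v := by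
  ext x
  simp only [prim, ContinuousMap.coe_mk, ContinuousMap.add_apply]
  rw [← intervalIntegral.integral_add (integrable_L2D u).intervalIntegrable
    (integrable_L2D v).intervalIntegrable]
  refine intervalIntegral.integral_congr_ae_restrict (ae_restrict_of_ae ?_)
  filter_upwards [Lp.coeFn_add u v] with x hx
  rw [hx, Pi.add_apply]

theorem prim_smul (c : ℝ) (u : L2D) : prim (c • u) = c • prim u := by
  ext x
  simp only [prim, ContinuousMap.coe_mk, ContinuousMap.smul_apply, smul_eq_mul]
  rw [← intervalIntegral.integral_const_mul]
  refine intervalIntegral.integral_congr_ae_restrict (ae_restrict_of_ae ?_)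
  filter_upwards [Lp.coeFn_smul c u] with x hx
  rw [hx, Pi.smul_apply, smul_eq_mul]

theorem integral_abs_le_norm (u : L2D) : ∫ x, |u x| ∂volD ≤ ‖u‖ := by
  have h : ∫ x, |u x| ∂volD = ⟪one2, |u|⟫_ℝ := by
    rw [inner_one2]
    refine integral_congr_ae ?_
    filter_upwards [Lp.coeFn_abs u] with x hx
    rw [hx]
  rw [h]
  refine (real_inner_le_norm _ _).trans ?_
  rw [norm_one2, one_mul, norm_abs_eq_norm]

theorem abs_prim_le (u : L2D) (x : ℝ) : |prim u x| ≤ ‖u‖ := by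
  refine le_trans ?_ (integral_abs_le_norm u)
  refine (intervalIntegral.norm_integral_le_integral_norm_uIoc (f := u) (μ := volD)).trans ?_
  exact setIntegral_le_integral (integrable_L2D u).norm
    (Filter.Eventually.of_forall fun x => norm_nonneg _)

theorem norm_le_of_abs_le (u : L2D) {C : ℝ} (hC : 0 ≤ C) (h : ∀ᵐ x ∂volD, |u x| ≤ C) :
    ‖u‖ ≤ C := by
  have := Lp.norm_le_of_ae_bound (f := u) hC h
  simpa [measureUnivNNReal] using this

/-- The Volterra operator `u ↦ ∫₀ˣ u` on `L²(D)`. -/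
def volterra : L2D →L[ℝ] L2D :=
  LinearMap.mkContinuous
    { toFun := fun u => toL2 (prim u)
      map_add' := fun u v => by rw [prim_add, map_add]
      map_smul' := fun c u => by rw [prim_smul, map_smul, RingHom.id_apply] } 1 fun u => by
    rw [one_mul]
    refine norm_le_of_abs_le _ (norm_nonneg u) ?_
    filter_upwards [coeFn_toL2 (prim u)] with x hx
    exact (congrArg _ hx).trans_le (abs_prim_le u x)

theorem volterra_apply (u : L2D) : volterra u = toL2 (prim u) := rfl

theorem absolutelyContinuous_prim (u : L2D) :
    AbsolutelyContinuousOnInterval (fun x => ∫ t in (0 : ℝ)..x, u t) 0 1 :=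
  (intervalIntegrable_L2D u).absolutelyContinuousOnInterval_intervalIntegral (by simp)

theorem ae_deriv_prim (u : L2D) :
    ∀ᵐ x ∂volD, deriv (fun x => ∫ t in (0 : ℝ)..x, u t) x = u x := by
  rw [ae_restrict_iff' measurableSet_Ioo]
  filter_upwards [(intervalIntegrable_L2D u).ae_hasDerivAt_integral] with x hx hxD
  refine (hx ?_ 0 (by simp)).deriv
  rw [uIcc_of_le zero_le_one]
  exact Ioo_subset_Icc_self hxD

/-- Integration by parts for absolutely continuous primitives: the boundary term at `0` vanishes,
and the one at `1` is the product of the means. -/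
theorem inner_volterra_add (u v : L2D) :
    ⟪volterra u, v⟫_ℝ + ⟪u, volterra v⟫_ℝ = ⟪one2, u⟫_ℝ * ⟪one2, v⟫_ℝ := by
  have h := (absolutelyContinuous_prim u).integral_mul_deriv_eq_deriv_mul
    (absolutelyContinuous_prim v)
  rw [← integral_volD, ← integral_volD (fun x => deriv _ x * _)] at h
  have e1 : ⟪volterra u, v⟫_ℝ = ∫ x, (∫ t in (0 : ℝ)..x, u t) *
      deriv (fun x => ∫ t in (0 : ℝ)..x, v t) x ∂volD := by
    rw [inner_L2D]
    refine integral_congr_ae ?_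
    filter_upwards [coeFn_toL2 (prim u), ae_deriv_prim v, ae_restrict_mem measurableSet_Ioo]
      with x h1 h2 h3
    rw [volterra_apply, h1, h2, prim_apply _ (Ioo_subset_Icc_self h3)]
  have e2 : ⟪u, volterra v⟫_ℝ = ∫ x, deriv (fun x => ∫ t in (0 : ℝ)..x, u t) x *
      (∫ t in (0 : ℝ)..x, v t) ∂volD := by
    rw [inner_L2D]
    refine integral_congr_ae ?_
    filter_upwards [coeFn_toL2 (prim v), ae_deriv_prim u, ae_restrict_mem measurableSet_Ioo]
      with x h1 h2 h3
    rw [volterra_apply, h1, h2, prim_apply _ (Ioo_subset_Icc_self h3)]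
  rw [e1, e2, h, inner_one2, inner_one2, integral_volD (fun x => u x),
    integral_volD (fun x => v x)]
  simp

/-! ### The Green operator of `-∂²` -/

/-- Removal of the mean value. -/
def meanFree : L2D →L[ℝ] L2D := ContinuousLinearMap.id ℝ L2D - (innerSL ℝ one2).smulRight one2

theorem meanFree_apply (u : L2D) : meanFree u = u - ⟪one2, u⟫_ℝ • one2 := rfl

theorem inner_one2_self : ⟪one2, one2⟫_ℝ = 1 := by
  rw [real_inner_self_eq_norm_sq, norm_one2, one_pow]

theorem inner_one2_meanFree (u : L2D) : ⟪one2, meanFree u⟫_ℝ = 0 := by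
  rw [meanFree_apply, inner_sub_right, inner_smul_right, inner_one2_self]
  ring

theorem inner_meanFree_left (u v : L2D) : ⟪meanFree u, v⟫_ℝ = ⟪u, meanFree v⟫_ℝ := by
  simp only [meanFree_apply, inner_sub_left, inner_sub_right, inner_smul_left, inner_smul_right,
    real_inner_comm one2, RCLike.conj_to_real]
  ring

/-- `u ↦ ∫₀ˣ u - c` with `c` such that the result has mean value `0`. -/
def gradOp : L2D →L[ℝ] L2D := meanFree ∘L volterra

theorem gradOp_apply (u : L2D) : gradOp u = meanFree (volterra u) := rfl

/-- The solution operator `A` of `-∂²` with homogeneous Dirichlet conditions. -/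
def green : L2D →L[ℝ] L2D := -(volterra ∘L gradOp)

theorem green_apply (u : L2D) : green u = -volterra (gradOp u) := rfl

/-- `gradOp u = -∂(Au)` has mean zero, so the boundary term of `inner_volterra_add` drops out. This
is the Dirichlet form; symmetry of `A` follows. -/
theorem inner_green (u v : L2D) : ⟪green u, v⟫_ℝ = ⟪gradOp u, gradOp v⟫_ℝ := by
  have h := inner_volterra_add (gradOp u) v
  have h0 : ⟪one2, gradOp u⟫_ℝ = 0 := inner_one2_meanFree _
  have h1 : ⟪gradOp u, gradOp v⟫_ℝ = ⟪gradOp u, volterra v⟫_ℝ := by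
    rw [gradOp_apply v, ← inner_meanFree_left, meanFree_apply, h0, zero_smul, sub_zero]
  rw [h0, zero_mul] at h
  rw [green_apply, inner_neg_left, h1]
  linarith

theorem inner_green_comm (u v : L2D) : ⟪green u, v⟫_ℝ = ⟪u, green v⟫_ℝ := by
  rw [inner_green, ← real_inner_comm, ← inner_green, real_inner_comm]

/-- The continuous representative of `green u`. -/
def greenRep (u : L2D) : C(ℝ, ℝ) := -prim (gradOp u)

theorem green_eq_toL2 (u : L2D) : green u = toL2 (greenRep u) := by
  rw [green_apply, greenRep, map_neg, volterra_apply]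

theorem greenRep_zero (u : L2D) : greenRep u 0 = 0 := by
  simp [greenRep, prim_zero]

theorem greenRep_one (u : L2D) : greenRep u 1 = 0 := by
  have h0 : ⟪one2, gradOp u⟫_ℝ = 0 := inner_one2_meanFree _
  simp [greenRep, prim_one, h0]

theorem green_mem_zeroTrace (u : L2D) : green u ∈ zeroTrace :=
  ⟨greenRep u, (greenRep u).continuous.continuousOn, by
    rw [green_eq_toL2]
    exact coeFn_toL2 _, greenRep_zero u, greenRep_one u⟩

theorem toL2_eq_volterra {F f : C(ℝ, ℝ)} (h : ∀ x, HasDerivAt F (f x) x) :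
    toL2 F = volterra (toL2 f) + F 0 • one2 := by
  have e : ∀ x ∈ Icc (0 : ℝ) 1, prim (toL2 f) x = F x - F 0 := by
    intro x hx
    rw [← intervalIntegral.integral_eq_sub_of_hasDerivAt (fun y _ => h y)
      (f.continuous.intervalIntegrable 0 x), ← intervalIntegral_volD _ (by simp) hx]
    exact intervalIntegral.integral_congr_ae_restrict (ae_restrict_of_ae (coeFn_toL2 f))
  rw [one2, volterra_apply, ← map_smul, ← map_add]
  apply Lp.ext
  filter_upwards [coeFn_toL2 F, coeFn_toL2 (prim (toL2 f) + F 0 • 1),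
    ae_restrict_mem measurableSet_Ioo] with x h1 h2 h3
  rw [h1, h2]
  simp [e x (Ioo_subset_Icc_self h3)]

/-! ### Calculus of weak derivatives -/

/-- The test functions on `D`. -/
structure IsTest (φ : ℝ → ℝ) : Prop where
  contDiff : ContDiff ℝ ∞ φ
  hasCompactSupport : HasCompactSupport φ
  tsupport_subset : tsupport φ ⊆ Ioo (0 : ℝ) 1

/-- A test function as a continuous map. -/
def IsTest.toC {φ : ℝ → ℝ} (h : IsTest φ) : C(ℝ, ℝ) := ⟨φ, h.contDiff.continuous⟩

theorem IsTest.eq_zero {φ : ℝ → ℝ} (h : IsTest φ) {x : ℝ} (hx : x ∉ Ioo (0 : ℝ) 1) :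
    φ x = 0 :=
  image_eq_zero_of_notMem_tsupport fun h' => hx (h.tsupport_subset h')

theorem IsTest.deriv {φ : ℝ → ℝ} (h : IsTest φ) : IsTest (deriv φ) where
  contDiff := (contDiff_infty_iff_deriv.mp h.contDiff).2
  hasCompactSupport := h.hasCompactSupport.deriv
  tsupport_subset := tsupport_deriv_subset.trans h.tsupport_subset

theorem IsTest.iteratedDeriv {φ : ℝ → ℝ} (h : IsTest φ) (k : ℕ) : IsTest (iteratedDeriv k φ) := by
  induction k with
  | zero => rwa [iteratedDeriv_zero]
  | succ k ih =>
    rw [iteratedDeriv_succ]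
    exact ih.deriv

theorem iteratedDeriv_add_index (j k : ℕ) (φ : ℝ → ℝ) :
    iteratedDeriv (j + k) φ = iteratedDeriv j (iteratedDeriv k φ) := by
  simp only [iteratedDeriv_eq_iterate, Function.iterate_add_apply]

theorem HasWeakDeriv.trans {j k : ℕ} {u w z : L2D} (h : HasWeakDeriv j u w)
    (h' : HasWeakDeriv k w z) : HasWeakDeriv (j + k) u z := by
  intro φ h1 h2 h3
  have ht := (IsTest.mk h1 h2 h3).iteratedDeriv k
  rw [iteratedDeriv_add_index, h _ ht.1 ht.2 ht.3, h' φ h1 h2 h3, pow_add, mul_assoc]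

theorem HasWeakDeriv.of_add {j k : ℕ} {u w z : L2D} (h : HasWeakDeriv j u w)
    (h' : HasWeakDeriv (j + k) u z) : HasWeakDeriv k w z := by
  intro φ h1 h2 h3
  have ht := (IsTest.mk h1 h2 h3).iteratedDeriv k
  have e := h' φ h1 h2 h3
  rw [iteratedDeriv_add_index, h _ ht.1 ht.2 ht.3, pow_add, mul_assoc] at e
  exact mul_left_cancel₀ (pow_ne_zero j (by norm_num : (-1 : ℝ) ≠ 0)) e

theorem hasWeakDeriv_zero_order (u : L2D) : HasWeakDeriv 0 u u := by
  intro φ _ _ _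
  simp

theorem hasWeakDeriv_one_iff {u w : L2D} : HasWeakDeriv 1 u w ↔
    ∀ (φ : ℝ → ℝ) (h : IsTest φ), ⟪u, toL2 h.deriv.toC⟫_ℝ = -⟪w, toL2 h.toC⟫_ℝ := by
  simp only [HasWeakDeriv, iteratedDeriv_one, pow_one, inner_toL2]
  constructor
  · intro h φ hφ
    exact (h φ hφ.1 hφ.2 hφ.3).trans (by rw [neg_one_mul]; rfl)
  · intro h φ h1 h2 h3
    exact (h φ ⟨h1, h2, h3⟩).trans (by rw [neg_one_mul]; rfl)

theorem IsTest.toL2_eq_volterra {φ : ℝ → ℝ} (h : IsTest φ) :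
    toL2 h.toC = volterra (toL2 h.deriv.toC) := by
  have hd : ∀ x, HasDerivAt h.toC (h.deriv.toC x) x := fun x =>
    ((h.contDiff.differentiable (by simp)) x).hasDerivAt
  have h0 : h.toC 0 = 0 := h.eq_zero (by simp)
  rw [CHC.toL2_eq_volterra hd, h0, zero_smul, add_zero]

theorem IsTest.inner_one2_deriv {φ : ℝ → ℝ} (h : IsTest φ) :
    ⟪one2, toL2 h.deriv.toC⟫_ℝ = 0 := by
  rw [one2, inner_toL2_toL2]
  have e : ∫ x in (0 : ℝ)..1, _root_.deriv φ x = φ 1 - φ 0 :=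
    intervalIntegral.integral_deriv_eq_sub
      (fun x _ => (h.contDiff.differentiable (by simp)) x)
      (h.deriv.contDiff.continuous.intervalIntegrable _ _)
  rw [h.eq_zero (by simp), h.eq_zero (by simp), sub_zero] at e
  simpa [IsTest.toC] using e

theorem hasWeakDeriv_volterra (w : L2D) : HasWeakDeriv 1 (volterra w) w := by
  rw [hasWeakDeriv_one_iff]
  intro φ h
  have e := inner_volterra_add w (toL2 h.deriv.toC)
  rw [h.inner_one2_deriv, mul_zero, ← h.toL2_eq_volterra] at e
  linarith

theorem hasWeakDeriv_one2 : HasWeakDeriv 1 one2 0 := by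
  rw [hasWeakDeriv_one_iff]
  intro φ h
  rw [h.inner_one2_deriv, inner_zero_left, neg_zero]

theorem exists_Icc_of_isTest {g : ℝ → ℝ} (hg : IsTest g) :
    ∃ a b : ℝ, 0 < a ∧ b < 1 ∧ (∀ x ≤ a, g x = 0) ∧ ∀ x, b ≤ x → g x = 0 := by
  rcases (tsupport g).eq_empty_or_nonempty with he | hne
  · have : ∀ x, g x = 0 := fun x => image_eq_zero_of_notMem_tsupport (by simp [he])
    exact ⟨1 / 2, 1 / 2, by norm_num, by norm_num, fun x _ => this x, fun x _ => this x⟩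
  · have hc : IsCompact (tsupport g) := hg.hasCompactSupport
    have h1 := hg.tsupport_subset (hc.sInf_mem hne)
    have h2 := hg.tsupport_subset (hc.sSup_mem hne)
    refine ⟨sInf (tsupport g) / 2, (sSup (tsupport g) + 1) / 2, by linarith [h1.1],
      by linarith [h2.2], fun x hx => ?_, fun x hx => ?_⟩
    · refine image_eq_zero_of_notMem_tsupport fun h => ?_
      have := csInf_le hc.bddBelow h
      linarith [h1.1]
    · refine image_eq_zero_of_notMem_tsupport fun h => ?_
      have := le_csSup hc.bddAbove h
      linarith [h2.2]

/-- The primitive from `0` vanishes to the left of the support of `g`, and to the right of it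
because the total integral is zero. -/
theorem exists_isTest_deriv_eq {g : ℝ → ℝ} (hg : IsTest g)
    (h0 : ∫ x in (0 : ℝ)..1, g x = 0) : ∃ φ, IsTest φ ∧ deriv φ = g := by
  obtain ⟨a, b, ha, hb, hga, hgb⟩ := exists_Icc_of_isTest hg
  have hc := hg.contDiff.continuous
  have hd : ∀ x, HasDerivAt (fun x => ∫ t in (0 : ℝ)..x, g t) (g x) x := fun x =>
    intervalIntegral.integral_hasDerivAt_right (hc.intervalIntegrable _ _)
      hc.stronglyMeasurable.stronglyMeasurableAtFilter hc.continuousAt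
  have hde : deriv (fun x => ∫ t in (0 : ℝ)..x, g t) = g := funext fun x => (hd x).deriv
  have hs : tsupport (fun x => ∫ t in (0 : ℝ)..x, g t) ⊆ Icc a b := by
    refine closure_minimal (fun x hx => ?_) isClosed_Icc
    by_contra hn
    apply hx
    rcases lt_or_ge x a with h | h
    · refine intervalIntegral.integral_zero_ae (Filter.Eventually.of_forall fun t ht => hga t ?_)
      exact ht.2.trans (max_le ha.le h.le)
    · have hbx : b < x := by
        by_contra h'
        exact hn ⟨h, not_lt.mp h'⟩
      have e := intervalIntegral.integral_add_adjacent_intervals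
        (hc.intervalIntegrable (μ := volume) 0 1) (hc.intervalIntegrable 1 x)
      rw [h0, zero_add] at e
      refine e.symm.trans ?_
      refine intervalIntegral.integral_zero_ae (Filter.Eventually.of_forall fun t ht => hgb t ?_)
      exact (le_min hb.le hbx.le).trans ht.1.le
  refine ⟨_, ⟨?_, ?_, ?_⟩, hde⟩
  · rw [contDiff_infty_iff_deriv, hde]
    exact ⟨fun x => (hd x).differentiableAt, hg.contDiff⟩
  · exact isCompact_Icc.of_isClosed_subset (isClosed_tsupport _) hs
  · exact hs.trans fun x hx => ⟨ha.trans_le hx.1, hx.2.trans_lt hb⟩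

theorem exists_isTest_inner_one2_ne_zero :
    ∃ (ρ : ℝ → ℝ) (h : IsTest ρ), ⟪one2, toL2 h.toC⟫_ℝ ≠ 0 := by
  let b : ContDiffBump (1 / 2 : ℝ) := ⟨1 / 8, 1 / 4, by norm_num, by norm_num⟩
  have hs : tsupport b ⊆ Ioo (0 : ℝ) 1 := by
    rw [b.tsupport_eq, Real.closedBall_eq_Icc]
    intro x hx
    simp only [b] at hx
    constructor <;> linarith [hx.1, hx.2]
  have hb : IsTest b := ⟨b.contDiff, b.hasCompactSupport, hs⟩
  refine ⟨b, hb, ?_⟩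
  have hp : 0 < ∫ x, b x := b.integral_pos
  rw [one2, inner_toL2_toL2, intervalIntegral.integral_of_le zero_le_one]
  rw [← setIntegral_eq_integral_of_forall_compl_eq_zero (s := Ioc (0 : ℝ) 1)
    (fun x hx => hb.eq_zero fun h => hx ⟨h.1, h.2.le⟩)] at hp
  simpa [IsTest.toC] using hp.ne'

theorem IsTest.sub_smul {f g : ℝ → ℝ} (hf : IsTest f) (hg : IsTest g) (c : ℝ) :
    IsTest (fun x => f x - c * g x) := by
  have hs : tsupport (fun x => f x - c * g x) ⊆ tsupport f ∪ tsupport g := by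
    refine closure_minimal (fun x hx => ?_) ((isClosed_tsupport f).union (isClosed_tsupport g))
    by_contra hn
    rw [mem_union, not_or] at hn
    apply hx
    simp [image_eq_zero_of_notMem_tsupport hn.1, image_eq_zero_of_notMem_tsupport hn.2]
  exact ⟨hf.contDiff.sub (contDiff_const.mul hg.contDiff),
    (hf.hasCompactSupport.isCompact.union hg.hasCompactSupport.isCompact).of_isClosed_subset
      (isClosed_tsupport _) hs,
    hs.trans (union_subset hf.tsupport_subset hg.tsupport_subset)⟩

/-- The du Bois-Reymond lemma. Subtracting from a test function the multiple of a fixed `ρ` that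
makes its mean zero leaves the derivative of a test function, which `u` annihilates. So pairing with
`u` is proportional to taking the mean. -/
theorem HasWeakDeriv.exists_eq_const {u : L2D} (h : HasWeakDeriv 1 u 0) :
    ∃ c : ℝ, u = c • one2 := by
  obtain ⟨ρ, hρ, hρ0⟩ := exists_isTest_inner_one2_ne_zero
  refine ⟨⟪u, toL2 hρ.toC⟫_ℝ / ⟪one2, toL2 hρ.toC⟫_ℝ,
    (hasWeakDeriv_zero_order u).unique (k := 0) ?_⟩
  intro φ h1 h2 h3
  have hφ : IsTest φ := ⟨h1, h2, h3⟩
  rw [hasWeakDeriv_one_iff] at h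
  rw [iteratedDeriv_zero, pow_zero, one_mul]
  change ∫ x, u x * hφ.toC x ∂volD = ∫ x, _ * hφ.toC x ∂volD
  rw [← inner_toL2, ← inner_toL2, inner_smul_left, RCLike.conj_to_real]
  set c := ⟪one2, toL2 hφ.toC⟫_ℝ / ⟪one2, toL2 hρ.toC⟫_ℝ with hc
  have ht := hφ.sub_smul hρ c
  have e : toL2 ht.toC = toL2 hφ.toC - c • toL2 hρ.toC := by
    rw [← map_smul, ← map_sub]
    rfl
  have h0 : ∫ x in (0 : ℝ)..1, φ x - c * ρ x = 0 := by
    have e1 : ⟪one2, toL2 ht.toC⟫_ℝ = 0 := by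
      rw [e, inner_sub_right, inner_smul_right, hc, div_mul_cancel₀ _ hρ0, sub_self]
    rw [one2, inner_toL2_toL2] at e1
    simpa [IsTest.toC] using e1
  obtain ⟨ψ, hψ, hd⟩ := exists_isTest_deriv_eq ht h0
  have e2 : toL2 hψ.deriv.toC = toL2 ht.toC := by
    congr 1
    ext x
    exact congrFun hd x
  have e3 := h ψ hψ
  rw [inner_zero_left, neg_zero, e2, e, inner_sub_right, inner_smul_right, sub_eq_zero] at e3
  rw [e3, hc]
  ring

theorem HasWeakDeriv.sub {k : ℕ} {u u' w w' : L2D} (h : HasWeakDeriv k u w)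
    (h' : HasWeakDeriv k u' w') : HasWeakDeriv k (u - u') (w - w') := by
  have := h.add (h'.smul (-1))
  simpa [sub_eq_add_neg] using this

theorem HasWeakDeriv.neg {k : ℕ} {u w : L2D} (h : HasWeakDeriv k u w) :
    HasWeakDeriv k (-u) (-w) := by
  simpa using h.smul (-1)

theorem HasWeakDeriv.exists_eq_volterra_add {u w : L2D} (h : HasWeakDeriv 1 u w) :
    ∃ c : ℝ, u = volterra w + c • one2 := by
  have h0 := h.sub (hasWeakDeriv_volterra w)
  rw [sub_self] at h0
  obtain ⟨c, hc⟩ := h0.exists_eq_const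
  exact ⟨c, by rw [← hc]; abel⟩

theorem hasWeakDeriv_meanFree {u w : L2D} (h : HasWeakDeriv 1 u w) :
    HasWeakDeriv 1 (meanFree u) w := by
  have := h.sub (hasWeakDeriv_one2.smul ⟪one2, u⟫_ℝ)
  rwa [smul_zero, sub_zero] at this

theorem hasWeakDeriv_gradOp (u : L2D) : HasWeakDeriv 1 (gradOp u) u :=
  hasWeakDeriv_meanFree (hasWeakDeriv_volterra u)

theorem hasWeakDeriv_one_green (u : L2D) : HasWeakDeriv 1 (green u) (-gradOp u) :=
  (hasWeakDeriv_volterra _).neg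

theorem hasWeakDeriv_two_green (u : L2D) : HasWeakDeriv 2 (green u) (-u) :=
  (hasWeakDeriv_one_green u).trans (hasWeakDeriv_gradOp u).neg

theorem hasWeakDeriv_three_green (u : L2D) {w : L2D} (h : HasWeakDeriv 1 u w) :
    HasWeakDeriv 3 (green u) (-w) := (hasWeakDeriv_two_green u).trans h.neg

theorem hasWeakDeriv_two_green_green (u : L2D) : HasWeakDeriv 4 (green (green u)) u := by
  have := (hasWeakDeriv_two_green (green u)).trans (hasWeakDeriv_two_green u).neg
  rwa [neg_neg] at this

/-! ### The range of `A` is `H² ∩ H¹₀` -/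

/-- Two functions with the same second weak derivative differ by an affine function; `volterra one2`
is the function `x`. -/
theorem exists_intermediate {u w : L2D} (h1 : ∃ z, HasWeakDeriv 1 u z) (h : HasWeakDeriv 2 u w) :
    ∃ a b : ℝ, u = -green w + a • one2 + b • volterra one2 := by
  obtain ⟨z, hz⟩ := h1
  have hzw : HasWeakDeriv 1 z w := hz.of_add (k := 1) h
  have h2 := hz.add (hasWeakDeriv_one_green w)
  have h3 : HasWeakDeriv 1 (z + -gradOp w) 0 := by
    simpa using hzw.add (hasWeakDeriv_gradOp w).neg
  obtain ⟨b, hb⟩ := h3.exists_eq_const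
  rw [hb] at h2
  obtain ⟨a, ha⟩ := h2.exists_eq_volterra_add
  refine ⟨a, b, ?_⟩
  rw [map_smul] at ha
  rw [eq_sub_of_add_eq ha]
  abel

/-- The affine remainder has a continuous representative that vanishes at both endpoints, so it is
zero. -/
theorem eq_neg_green_of_mem_zeroTrace {u w : L2D} (h1 : ∃ z, HasWeakDeriv 1 u z)
    (h : HasWeakDeriv 2 u w) (hu : u ∈ zeroTrace) : u = -green w := by
  obtain ⟨a, b, hab⟩ := exists_intermediate h1 h
  have hm := zeroTrace.add_mem hu (green_mem_zeroTrace w)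
  have e : u + green w = toL2 (a • 1 + b • prim one2) := by
    rw [hab, map_add, map_smul, map_smul, volterra_apply, one2]
    abel
  obtain ⟨g, hg, hug, hg0, hg1⟩ := hm
  rw [e] at hug
  have he := eqOn_of_ae_eq_volD ((coeFn_toL2 _).symm.trans hug)
    (ContinuousMap.continuous _).continuousOn hg
  have e0 := he (left_mem_Icc.mpr zero_le_one)
  have e1 := he (right_mem_Icc.mpr zero_le_one)
  simp only [ContinuousMap.add_apply, ContinuousMap.smul_apply, ContinuousMap.one_apply,
    prim_zero, prim_one, inner_one2_self, hg0, hg1, smul_eq_mul, mul_one, mul_zero,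
    add_zero] at e0 e1
  rw [e0, zero_add] at e1
  rw [hab, e0, e1]
  simp

theorem mem_sobolev_two_iff_green {u : L2D} : u ∈ sobolev 2 ⊓ H10 ↔ u ∈ green.range := by
  constructor
  · rintro ⟨h, -, hz⟩
    obtain ⟨w, hw⟩ := h 2 le_rfl
    exact ⟨-w, by simp [eq_neg_green_of_mem_zeroTrace (h 1 one_le_two) hw hz]⟩
  · rintro ⟨w, rfl⟩
    have h : ∀ l ≤ 2, ∃ z, HasWeakDeriv l (green w) z := by
      intro l hl
      interval_cases l
      exacts [⟨_, hasWeakDeriv_zero_order _⟩, ⟨_, hasWeakDeriv_one_green w⟩,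
        ⟨_, hasWeakDeriv_two_green w⟩]
    exact ⟨h, fun l hl => h l (hl.trans one_le_two), green_mem_zeroTrace w⟩

theorem green_injective : Function.Injective green := by
  intro u v h
  have h1 := hasWeakDeriv_two_green u
  rw [h] at h1
  exact neg_injective (h1.unique (hasWeakDeriv_two_green v))

/-! ### Sine coefficients and the spaces `Ḣ^m` -/

/-- The function `ε_k` as a continuous map. -/
def epsC (k : ℕ) : C(ℝ, ℝ) := ⟨eps k, by unfold eps; fun_prop⟩

/-- The function `ε_k` as an element of `L²(D)`. -/
def eps2 (k : ℕ) : L2D := toL2 (epsC k)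

theorem sineCoeff_eq_inner (v : L2D) (k : ℕ) : sineCoeff v k = ⟪v, eps2 k⟫_ℝ := by
  rw [eps2, inner_toL2]
  rfl

theorem hasWeakDeriv_toL2 {F f : C(ℝ, ℝ)} (h : ∀ x, HasDerivAt F (f x) x) :
    HasWeakDeriv 1 (toL2 F) (toL2 f) := by
  rw [toL2_eq_volterra h]
  have := (hasWeakDeriv_volterra (toL2 f)).add (hasWeakDeriv_one2.smul (F 0))
  rwa [smul_zero, add_zero] at this

theorem lam_pos {k : ℕ} (hk : 0 < k) : 0 < lam k :=
  mul_pos (by exact_mod_cast hk) Real.pi_pos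

theorem one_le_lam {k : ℕ} (hk : 0 < k) : 1 ≤ lam k := by
  have h1 : (1 : ℝ) ≤ k := by exact_mod_cast hk
  have h2 := Real.pi_gt_three
  unfold lam
  nlinarith

/-- The derivative of `ε_k`. -/
def epsDerivC (k : ℕ) : C(ℝ, ℝ) :=
  ⟨fun z => Real.sqrt 2 * (lam k * Real.cos (lam k * z)), by fun_prop⟩

theorem hasDerivAt_epsC (k : ℕ) (x : ℝ) : HasDerivAt (epsC k) (epsDerivC k x) x := by
  have h := (((hasDerivAt_id x).const_mul (lam k)).sin).const_mul (Real.sqrt 2)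
  refine h.congr_deriv ?_
  simp [epsDerivC, mul_comm]

theorem hasDerivAt_epsDerivC (k : ℕ) (x : ℝ) :
    HasDerivAt (epsDerivC k) ((-(lam k ^ 2) • epsC k) x) x := by
  have h := ((((hasDerivAt_id x).const_mul (lam k)).cos).const_mul (lam k)).const_mul (Real.sqrt 2)
  refine h.congr_deriv ?_
  simp [epsC, eps]
  ring

theorem sin_lam (k : ℕ) : Real.sin (lam k) = 0 := Real.sin_nat_mul_pi k

theorem cos_lam (k : ℕ) : Real.cos (lam k) = (-1) ^ k := Real.cos_nat_mul_pi k

theorem eps2_eq_green (k : ℕ) : eps2 k = lam k ^ 2 • green (eps2 k) := by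
  have h1 := hasWeakDeriv_toL2 (hasDerivAt_epsC k)
  have h2 := h1.trans (hasWeakDeriv_toL2 (hasDerivAt_epsDerivC k))
  have hz : eps2 k ∈ zeroTrace := ⟨epsC k, (epsC k).continuous.continuousOn, coeFn_toL2 _,
    by simp [epsC, eps], by simp [epsC, eps, sin_lam]⟩
  have := eq_neg_green_of_mem_zeroTrace ⟨_, h1⟩ h2 hz
  rw [map_smul, map_smul, neg_smul, neg_neg] at this
  exact this

theorem lam_sq_mul_sineCoeff_green (u : L2D) (k : ℕ) :
    lam k ^ 2 * sineCoeff (green u) k = sineCoeff u k := by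
  rw [sineCoeff_eq_inner, sineCoeff_eq_inner, inner_green_comm, ← real_inner_smul_right,
    ← eps2_eq_green]

theorem integral_sin_lam_sq {k : ℕ} (hk : 0 < k) :
    ∫ x in (0 : ℝ)..1, eps k x * eps k x = 1 := by
  have hl := (lam_pos hk).ne'
  have h : ∀ x, HasDerivAt (fun x => x - Real.sin (lam k * x) * Real.cos (lam k * x) / lam k)
      (eps k x * eps k x) x := by
    intro x
    have hs := ((hasDerivAt_id x).const_mul (lam k)).sin
    have hc := ((hasDerivAt_id x).const_mul (lam k)).cos
    refine ((hasDerivAt_id x).sub ((hs.mul hc).div_const (lam k))).congr_deriv ?_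
    have e := Real.sin_sq_add_cos_sq (lam k * x)
    have e2 := Real.mul_self_sqrt (zero_le_two (α := ℝ))
    simp only [id, eps]
    field_simp
    linear_combination (-1) * e - Real.sin (lam k * x) ^ 2 * e2
  rw [intervalIntegral.integral_eq_sub_of_hasDerivAt (fun x _ => h x)
    (Continuous.intervalIntegrable (by unfold eps; fun_prop) _ _)]
  simp [sin_lam]

/-- Orthogonality holds because the `ε_k` are eigenvectors of the symmetric operator `A` with
distinct eigenvalues `λ_k⁻²`. Only Bessel's inequality is drawn from this, not completeness. -/
theorem orthonormal_eps2 : Orthonormal ℝ fun k : ℕ => eps2 (k + 1) := by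
  constructor
  · intro k
    have h : ⟪eps2 (k + 1), eps2 (k + 1)⟫_ℝ = 1 := by
      rw [eps2, inner_toL2_toL2]
      exact integral_sin_lam_sq k.succ_pos
    rw [real_inner_self_eq_norm_sq] at h
    exact (pow_eq_one_iff_of_nonneg (norm_nonneg _) two_ne_zero).mp h
  · intro j k hjk
    have h1 : ⟪eps2 (j + 1), eps2 (k + 1)⟫_ℝ
        = lam (j + 1) ^ 2 * ⟪green (eps2 (j + 1)), eps2 (k + 1)⟫_ℝ := by
      conv_lhs => rw [eps2_eq_green (j + 1), real_inner_smul_left]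
    have h2 : ⟪eps2 (j + 1), eps2 (k + 1)⟫_ℝ
        = lam (k + 1) ^ 2 * ⟪green (eps2 (j + 1)), eps2 (k + 1)⟫_ℝ := by
      conv_lhs => rw [eps2_eq_green (k + 1), real_inner_smul_right, ← inner_green_comm]
    have hne : lam (j + 1) ≠ lam (k + 1) := by
      intro h
      apply hjk
      have := mul_right_cancel₀ Real.pi_ne_zero h
      exact Nat.succ_injective (by exact_mod_cast this)
    have hne2 : lam (j + 1) ^ 2 - lam (k + 1) ^ 2 ≠ 0 := by
      rw [sub_ne_zero]
      exact fun h => hne ((sq_eq_sq₀ (lam_pos j.succ_pos).le (lam_pos k.succ_pos).le).mp h)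
    have h3 : (lam (j + 1) ^ 2 - lam (k + 1) ^ 2) *
        ⟪green (eps2 (j + 1)), eps2 (k + 1)⟫_ℝ = 0 := by
      rw [sub_mul, ← h1, ← h2, sub_self]
    rw [h1, (mul_eq_zero.mp h3).resolve_left hne2, mul_zero]

theorem summable_sineCoeff_sq (u : L2D) : Summable fun k : ℕ => sineCoeff u (k + 1) ^ 2 := by
  refine (orthonormal_eps2.inner_products_summable (x := u)).congr fun k => ?_
  rw [sineCoeff_eq_inner, real_inner_comm, Real.norm_eq_abs, sq_abs]

theorem lam_pow_nonneg (k m : ℕ) : 0 ≤ lam k ^ m :=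
  pow_nonneg (mul_nonneg k.cast_nonneg Real.pi_pos.le) m

theorem green_mem_dotH_one (u : L2D) : green u ∈ dotH 1 := by
  refine (summable_sineCoeff_sq u).of_nonneg_of_le (fun k => mul_nonneg (lam_pow_nonneg _ _) (sq_nonneg _)) fun k => ?_
  have h : 1 ≤ lam (k + 1) := one_le_lam k.succ_pos
  rw [← lam_sq_mul_sineCoeff_green u, mul_pow, ← pow_mul]
  gcongr
  norm_num

theorem green_green_mem_dotH_four (u : L2D) : green (green u) ∈ dotH 4 := by
  refine (summable_sineCoeff_sq u).congr fun k => ?_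
  rw [← lam_sq_mul_sineCoeff_green u, ← lam_sq_mul_sineCoeff_green (green u)]
  ring

theorem sub_mem_dotH {m : ℕ} {u v : L2D} (hu : u ∈ dotH m) (hv : v ∈ dotH m) :
    u - v ∈ dotH m := by
  refine ((hu.add hv).mul_left 2).of_nonneg_of_le (fun k => ?_) fun k => ?_
  · exact mul_nonneg (lam_pow_nonneg _ _) (sq_nonneg _)
  · have h := lam_pow_nonneg (k + 1) (2 * m)
    have e : sineCoeff (u - v) (k + 1) = sineCoeff u (k + 1) - sineCoeff v (k + 1) := by
      simp only [sineCoeff_eq_inner, inner_sub_left]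
    rw [e, ← mul_add, mul_left_comm]
    gcongr
    nlinarith [sq_nonneg (sineCoeff u (k + 1) + sineCoeff v (k + 1))]

theorem sineCoeff_one2 {k : ℕ} (hk : 0 < k) :
    sineCoeff one2 k = Real.sqrt 2 / lam k * (1 - (-1) ^ k) := by
  have hl := (lam_pos hk).ne'
  rw [sineCoeff_eq_inner, one2, eps2, inner_toL2_toL2]
  have h : ∀ x, HasDerivAt (fun x => -(Real.sqrt 2 / lam k * Real.cos (lam k * x)))
      ((1 : C(ℝ, ℝ)) x * epsC k x) x := by
    intro x
    refine ((((hasDerivAt_id x).const_mul (lam k)).cos).const_mul _).neg.congr_deriv ?_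
    simp only [id, epsC, eps, ContinuousMap.one_apply, ContinuousMap.coe_mk]
    field_simp
  rw [intervalIntegral.integral_eq_sub_of_hasDerivAt (fun x _ => h x)
    (Continuous.intervalIntegrable (by fun_prop) _ _)]
  simp [cos_lam]
  ring

theorem sineCoeff_volterra_one2 {k : ℕ} (hk : 0 < k) :
    sineCoeff (volterra one2) k = Real.sqrt 2 / lam k * (-(-1) ^ k) := by
  have hl := (lam_pos hk).ne'
  have e : volterra one2 = toL2 (ContinuousMap.id ℝ) := by
    have := toL2_eq_volterra (F := ContinuousMap.id ℝ) (f := 1) fun x => hasDerivAt_id x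
    rw [this, one2]
    simp
  rw [sineCoeff_eq_inner, e, eps2, inner_toL2_toL2]
  have h : ∀ x, HasDerivAt (fun x => Real.sqrt 2 / lam k *
      (Real.sin (lam k * x) / lam k - x * Real.cos (lam k * x)))
      ((ContinuousMap.id ℝ) x * epsC k x) x := by
    intro x
    have hs := ((hasDerivAt_id x).const_mul (lam k)).sin
    have hc := ((hasDerivAt_id x).const_mul (lam k)).cos
    refine ((hs.div_const (lam k)).sub ((hasDerivAt_id x).mul hc)).const_mul _ |>.congr_deriv ?_
    simp only [id, epsC, eps, ContinuousMap.id_apply, ContinuousMap.coe_mk]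
    field_simp
    ring
  rw [intervalIntegral.integral_eq_sub_of_hasDerivAt (fun x _ => h x)
    (Continuous.intervalIntegrable (by fun_prop) _ _)]
  simp [cos_lam, sin_lam]

/-- Dividing by `l³` isolates `α`; once `α = 0`, dividing by `l` isolates `γ`. -/
theorem eq_zero_of_tendsto_cube_add {α γ : ℝ} {l : ℕ → ℝ} (hl : Filter.Tendsto l .atTop .atTop)
    (h : Filter.Tendsto (fun n => l n ^ 3 * α + l n * γ) .atTop (nhds 0)) : α = 0 ∧ γ = 0 := by
  have hi : Filter.Tendsto (fun n => (l n)⁻¹) .atTop (nhds 0) := hl.inv_tendsto_atTop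
  have hα : α = 0 := by
    have h1 := h.mul (hi.pow 3)
    have h2 : Filter.Tendsto (fun n => α + (l n)⁻¹ ^ 2 * γ) .atTop (nhds (α + 0 ^ 2 * γ)) :=
      tendsto_const_nhds.add ((hi.pow 2).mul_const γ)
    have h3 := h1.congr' (f₂ := fun n => α + (l n)⁻¹ ^ 2 * γ) (by
      filter_upwards [hl.eventually_gt_atTop 0] with n hn
      field_simp)
    simpa using tendsto_nhds_unique h2 h3
  refine ⟨hα, ?_⟩
  subst hα
  have h1 := h.mul hi
  have h3 := h1.congr' (f₂ := fun _ => γ) (by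
      filter_upwards [hl.eventually_gt_atTop 0] with n hn
      field_simp
      ring)
  simpa using tendsto_nhds_unique tendsto_const_nhds h3

theorem tendsto_lam : Filter.Tendsto lam .atTop .atTop :=
  tendsto_natCast_atTop_atTop.atTop_mul_const Real.pi_pos

theorem sineCoeff_affine {k : ℕ} (hk : 0 < k) (a b : ℝ) :
    sineCoeff (a • one2 + b • volterra one2) k
      = Real.sqrt 2 / lam k * (a * (1 - (-1) ^ k) + b * (-(-1) ^ k)) := by
  have e3 := sineCoeff_one2 hk
  have e4 := sineCoeff_volterra_one2 hk
  rw [sineCoeff_eq_inner] at e3 e4 ⊢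
  rw [inner_add_left, real_inner_smul_left, real_inner_smul_left, e3, e4]
  ring

theorem lam_pow_four_mul_sineCoeff_cubic {k : ℕ} (hk : 0 < k) (a b c d : ℝ) :
    lam k ^ 4 * sineCoeff (a • one2 + b • volterra one2 +
        green (c • one2 + d • volterra one2)) k
      = Real.sqrt 2 * (lam k ^ 3 * (a * (1 - (-1) ^ k) + b * (-(-1) ^ k))
        + lam k * (c * (1 - (-1) ^ k) + d * (-(-1) ^ k))) := by
  have hl := (lam_pos hk).ne'
  have e1 := lam_sq_mul_sineCoeff_green (c • one2 + d • volterra one2) k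
  have e5 : ∀ u v, sineCoeff (u + v) k = sineCoeff u k + sineCoeff v k := by
    intro u v
    simp only [sineCoeff_eq_inner, inner_add_left]
  rw [sineCoeff_affine hk] at e1
  rw [e5, sineCoeff_affine hk, mul_add, show lam k ^ 4 = lam k ^ 2 * lam k ^ 2 by ring,
    mul_assoc (lam k ^ 2) _ (sineCoeff (green _) k), e1]
  field_simp

/-- Summability forces `λ_k⁴` times the sine coefficient to tend to zero, whereas `1` and `x`
contribute order `λ_k³`, and their images under `A` order `λ_k`. Odd `k` yields `2a + b = 0` and
even `k` yields `b = 0`; the same holds for `c` and `d`. -/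
theorem eq_zero_of_mem_dotH_four {a b c d : ℝ}
    (h : a • one2 + b • volterra one2 + green (c • one2 + d • volterra one2) ∈ dotH 4) :
    (a = 0 ∧ b = 0) ∧ c = 0 ∧ d = 0 := by
  have ht2 : Filter.Tendsto (fun k : ℕ =>
      lam (k + 1) ^ 3 * (a * (1 - (-1) ^ (k + 1)) + b * (-(-1) ^ (k + 1)))
        + lam (k + 1) * (c * (1 - (-1) ^ (k + 1)) + d * (-(-1) ^ (k + 1)))) .atTop (nhds 0) := by
    have h1 := (Summable.tendsto_atTop_zero h).sqrt.const_mul (Real.sqrt 2)⁻¹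
    rw [Real.sqrt_zero, mul_zero] at h1
    refine (tendsto_zero_iff_abs_tendsto_zero _).mpr (h1.congr fun k => ?_)
    have hs : Real.sqrt 2 ≠ 0 := by positivity
    rw [show lam (k + 1) ^ (2 * 4) = (lam (k + 1) ^ 4) ^ 2 by ring, ← mul_pow,
      lam_pow_four_mul_sineCoeff_cubic k.succ_pos, Real.sqrt_sq_eq_abs, abs_mul,
      abs_of_nonneg (Real.sqrt_nonneg 2), inv_mul_cancel_left₀ hs]
    rfl
  have hm : Filter.Tendsto (fun n : ℕ => 2 * n) .atTop .atTop :=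
    Filter.tendsto_atTop_mono (fun n => by simp only [id]; omega) Filter.tendsto_id
  have ho : Filter.Tendsto (fun n : ℕ => 2 * n + 1) .atTop .atTop :=
    Filter.tendsto_atTop_mono (fun n => by omega) hm
  have ho' : Filter.Tendsto (fun n : ℕ => 2 * n + 1 + 1) .atTop .atTop :=
    Filter.tendsto_atTop_mono (fun n => by omega) ho
  have h0 := ht2.comp hm
  have h1 := ht2.comp ho
  have s0 : ∀ n : ℕ, (-1 : ℝ) ^ (2 * n + 1) = -1 := fun n => by rw [pow_succ, pow_mul]; simp
  have s1 : ∀ n : ℕ, (-1 : ℝ) ^ (2 * n + 1 + 1) = 1 := fun n => by rw [pow_succ, s0]; simp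
  simp only [Function.comp_def, s0, s1] at h0 h1
  obtain ⟨p1, p2⟩ := eq_zero_of_tendsto_cube_add (tendsto_lam.comp ho) h0
  obtain ⟨q1, q2⟩ := eq_zero_of_tendsto_cube_add (tendsto_lam.comp ho') h1
  refine ⟨⟨?_, ?_⟩, ?_, ?_⟩ <;> linarith

/-- Membership in `Ḣ⁴` plays the role of the conditions `v = ∂²v = 0` at the endpoints. Without it,
`v` and `A²w` may differ by a combination of `1`, `x`, `A1` and `Ax`. -/
theorem eq_green_green_of_mem_dotH_four {v w : L2D} (hv : v ∈ sobolev 4) (hd : v ∈ dotH 4)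
    (hw : HasWeakDeriv 4 v w) : v = green (green w) := by
  obtain ⟨v1, h1⟩ := hv 1 (by norm_num)
  obtain ⟨v2, h2⟩ := hv 2 (by norm_num)
  obtain ⟨v3, h3⟩ := hv 3 (by norm_num)
  obtain ⟨a, b, hab⟩ := exists_intermediate ⟨v1, h1⟩ h2
  obtain ⟨c, d, hcd⟩ := exists_intermediate ⟨v3, h2.of_add (k := 1) h3⟩ (h2.of_add (k := 2) hw)
  have e : v - green (green w) = a • one2 + b • volterra one2 +
      green ((-c) • one2 + (-d) • volterra one2) := by
    rw [hab, hcd]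
    simp only [map_add, map_neg, map_smul]
    module
  have hm := sub_mem_dotH hd (green_green_mem_dotH_four w)
  rw [e] at hm
  obtain ⟨⟨ha, hb⟩, hc, hd'⟩ := eq_zero_of_mem_dotH_four hm
  rw [ha, hb, hc, hd'] at e
  rw [← sub_eq_zero, e]
  simp

/-! ### Meshes, piecewise polynomials and local approximation -/

theorem sq_intervalIntegral_le {g : ℝ → ℝ} {a b : ℝ} (hab : a ≤ b)
    (hg : IntervalIntegrable g volume a b)
    (hg2 : IntervalIntegrable (fun x => g x ^ 2) volume a b) :
    (∫ x in a..b, g x) ^ 2 ≤ (b - a) * ∫ x in a..b, g x ^ 2 := by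
  rcases hab.eq_or_lt with rfl | hlt
  · simp
  have hp : 0 < b - a := sub_pos.mpr hlt
  set m := (∫ x in a..b, g x) / (b - a) with hm
  have h0 : 0 ≤ ∫ x in a..b, (g x - m) ^ 2 :=
    intervalIntegral.integral_nonneg hab fun x _ => sq_nonneg _
  have e : ∫ x in a..b, (g x - m) ^ 2
      = (∫ x in a..b, g x ^ 2) - 2 * m * (∫ x in a..b, g x) + m ^ 2 * (b - a) := by
    have e1 : ∀ x, (g x - m) ^ 2 = g x ^ 2 - 2 * m * g x + m ^ 2 := fun x => by ring
    simp only [e1]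
    rw [intervalIntegral.integral_add (hg2.sub (hg.const_mul _)) intervalIntegrable_const,
      intervalIntegral.integral_sub hg2 (hg.const_mul _), intervalIntegral.integral_const_mul,
      intervalIntegral.integral_const, smul_eq_mul, mul_comm (b - a)]
  have e2 : (∫ x in a..b, g x) = m * (b - a) := by rw [hm, div_mul_cancel₀ _ hp.ne']
  rw [e, e2] at h0
  rw [e2]
  nlinarith

namespace Mesh

variable (P : Mesh)

theorem size_ge (i : Fin P.N) : P.node i.succ - P.node i.castSucc ≤ P.size :=
  le_ciSup (f := fun i : Fin P.N => P.node i.succ - P.node i.castSucc)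
    (Set.finite_range _).bddAbove i

theorem node_mem (j : Fin (P.N + 1)) : P.node j ∈ Icc (0 : ℝ) 1 := by
  constructor
  · rw [← P.node_first]
    exact P.strictMono.monotone (Fin.zero_le j)
  · rw [← P.node_last]
    exact P.strictMono.monotone (Fin.le_last j)

theorem node_lt (i : Fin P.N) : P.node i.castSucc < P.node i.succ :=
  P.strictMono i.castSucc_lt_succ

theorem size_nonneg : 0 ≤ P.size :=
  Real.iSup_nonneg fun i => (sub_pos.mpr (P.node_lt i)).le

/-- The `i`-th element of the partition. -/
def elem (i : Fin P.N) : Set ℝ := Ioo (P.node i.castSucc) (P.node i.succ)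

theorem elem_subset (i : Fin P.N) : P.elem i ⊆ Ioo 0 1 :=
  Ioo_subset_Ioo (P.node_mem _).1 (P.node_mem _).2

theorem eq_of_mem_elem {i j : Fin P.N} {x : ℝ} (hi : x ∈ P.elem i) (hj : x ∈ P.elem j) :
    i = j := by
  have key : ∀ i j : Fin P.N, x ∈ P.elem i → x ∈ P.elem j → ¬ i < j := by
    intro i j hi hj hij
    have h : P.node i.succ ≤ P.node j.castSucc :=
      P.strictMono.monotone (Fin.succ_le_castSucc_iff.mpr hij)
    exact absurd (hi.2.trans_le h) (not_lt.mpr hj.1.le)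
  exact le_antisymm (not_lt.mp (key j i hj hi)) (not_lt.mp (key i j hi hj))

theorem ae_exists_mem_elem : ∀ᵐ x ∂volD, ∃ i, x ∈ P.elem i := by
  have h0 : ∀ᵐ x ∂volD, x ∉ Set.range P.node :=
    ae_restrict_of_ae ((Set.finite_range P.node).countable.ae_notMem volume)
  filter_upwards [h0, ae_restrict_mem measurableSet_Ioo] with x hx hxD
  by_contra! hn
  have : ∀ j, P.node j < x := by
    intro j
    induction j using Fin.induction with
    | zero => rw [P.node_first]; exact hxD.1
    | succ i ih =>
      have h1 : P.node i.succ ≤ x := not_lt.mp fun h => hn i ⟨ih, h⟩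
      exact h1.lt_of_ne fun h => hx ⟨_, h⟩
  have := this (Fin.last P.N)
  rw [P.node_last] at this
  exact absurd this (not_lt.mpr hxD.2.le)

/-- The piecewise polynomial function with coefficients `c`. -/
def ppFun (r : ℕ) (c : Fin P.N → Fin r → ℝ) (x : ℝ) : ℝ :=
  ∑ i, (P.elem i).indicator (fun x => ∑ j, c i j * x ^ (j : ℕ)) x

theorem ppFun_of_mem {r : ℕ} (c : Fin P.N → Fin r → ℝ) {i : Fin P.N} {x : ℝ} (hx : x ∈ P.elem i) :
    P.ppFun r c x = ∑ j, c i j * x ^ (j : ℕ) := by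
  rw [ppFun, Finset.sum_eq_single i (fun k _ hk => indicator_of_notMem
    (fun h => hk (P.eq_of_mem_elem h hx)) _) (by simp), indicator_of_mem hx]

theorem memLp_ppFun (r : ℕ) (c : Fin P.N → Fin r → ℝ) : MemLp (P.ppFun r c) 2 volD := by
  refine memLp_finsetSum _ fun i _ => MemLp.indicator measurableSet_Ioo ?_
  exact memLp_continuousMap ⟨fun x => ∑ j, c i j * x ^ (j : ℕ), by fun_prop⟩

/-- The piecewise polynomial with coefficients `c`, as an element of `L²(D)`. -/
def ppMap (r : ℕ) : (Fin P.N → Fin r → ℝ) →ₗ[ℝ] L2D where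
  toFun c := (P.memLp_ppFun r c).toLp
  map_add' c d := by
    rw [← MemLp.toLp_add]
    congr 1
    ext x
    simp only [ppFun, Pi.add_apply, ← Finset.sum_add_distrib]
    refine Finset.sum_congr rfl fun i _ => ?_
    by_cases hx : x ∈ P.elem i <;> simp [hx, add_mul, Finset.sum_add_distrib]
  map_smul' a c := by
    rw [RingHom.id_apply, ← MemLp.toLp_const_smul]
    congr 1
    ext x
    simp only [ppFun, Pi.smul_apply, smul_eq_mul, Finset.mul_sum]
    refine Finset.sum_congr rfl fun i _ => ?_
    by_cases hx : x ∈ P.elem i <;> simp [hx, mul_assoc, Finset.mul_sum]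

theorem coeFn_ppMap (r : ℕ) (c : Fin P.N → Fin r → ℝ) :
    (P.ppMap r c : ℝ → ℝ) =ᵐ[volD] P.ppFun r c := (P.memLp_ppFun r c).coeFn_toLp

theorem piecewisePoly_le_range (r : ℕ) : piecewisePoly P r ≤ LinearMap.range (P.ppMap (r + 1)) := by
  intro u hu
  choose p hp hup using hu
  refine ⟨fun i j => (p i).coeff j, Lp.ext ?_⟩
  filter_upwards [coeFn_ppMap P (r + 1) fun i j => (p i).coeff j, P.ae_exists_mem_elem,
    ae_all_iff.mpr hup] with x h1 ⟨i, hi⟩ h3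
  rw [h1, P.ppFun_of_mem _ hi, h3 i hi, Polynomial.eval_eq_sum_range' (Nat.lt_succ_of_le (hp i)),
    Finset.sum_range]

instance finiteDimensional_piecewisePoly (r : ℕ) : FiniteDimensional ℝ (piecewisePoly P r) :=
  Submodule.finiteDimensional_of_le (P.piecewisePoly_le_range r)

theorem ppMap_one_mem (c : Fin P.N → Fin 1 → ℝ) : P.ppMap 1 c ∈ piecewisePoly P 0 := by
  intro i
  refine ⟨Polynomial.C (c i 0), by simp, ?_⟩
  filter_upwards [coeFn_ppMap P 1 c] with x hx hxi
  rw [hx, P.ppFun_of_mem c hxi]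
  simp

theorem one2_mem_piecewisePoly (r : ℕ) : one2 ∈ piecewisePoly P r := by
  intro i
  refine ⟨1, by simp, ?_⟩
  filter_upwards [coeFn_toL2 1] with x hx _
  rw [one2, hx]
  simp

end Mesh

theorem exists_polynomial_antideriv (p : ℝ[X]) {r : ℕ} (hp : p.natDegree ≤ r) :
    ∃ q : ℝ[X], q.natDegree ≤ r + 1 ∧ Polynomial.derivative q = p := by
  refine ⟨∑ n ∈ Finset.range (r + 1),
    Polynomial.C (p.coeff n / (n + 1)) * Polynomial.X ^ (n + 1), ?_, ?_⟩
  · refine Polynomial.natDegree_sum_le_of_forall_le _ _ fun n hn => ?_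
    refine (Polynomial.natDegree_C_mul_X_pow_le _ _).trans ?_
    have := Finset.mem_range.mp hn
    omega
  · conv_rhs => rw [p.as_sum_range_C_mul_X_pow' (Nat.lt_succ_of_le hp)]
    rw [Polynomial.derivative_sum]
    refine Finset.sum_congr rfl fun n _ => ?_
    have : (n : ℝ) + 1 ≠ 0 := by positivity
    rw [Polynomial.derivative_C_mul_X_pow, Nat.add_sub_cancel]
    congr 2
    push_cast
    field_simp

theorem prim_sub_prim (u : L2D) (a x : ℝ) :
    prim u x - prim u a = ∫ t in a..x, u t ∂volD :=
  intervalIntegral.integral_interval_sub_left (integrable_L2D u).intervalIntegrable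
    (integrable_L2D u).intervalIntegrable

theorem volterra_mem_piecewisePoly {P : Mesh} {r : ℕ} {u : L2D} (hu : u ∈ piecewisePoly P r) :
    volterra u ∈ piecewisePoly P (r + 1) := by
  intro i
  obtain ⟨p, hp, hup⟩ := hu i
  obtain ⟨q, hq, hqd⟩ := exists_polynomial_antideriv p hp
  set a := P.node i.castSucc
  refine ⟨q + Polynomial.C (prim u a - q.eval a), ?_, ?_⟩
  · exact Polynomial.natDegree_add_le_of_degree_le hq (by simp)
  · filter_upwards [coeFn_toL2 (prim u)] with x hx hxi
    rw [volterra_apply, hx, Polynomial.eval_add, Polynomial.eval_C]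
    have hxD := P.elem_subset i hxi
    have e : ∫ t in a..x, u t ∂volD = ∫ t in a..x, p.eval t ∂volD := by
      rw [intervalIntegral.integral_of_le hxi.1.le, intervalIntegral.integral_of_le hxi.1.le]
      refine integral_congr_ae ?_
      filter_upwards [ae_restrict_of_ae hup, ae_restrict_mem measurableSet_Ioc] with t ht htx
      exact ht ⟨htx.1, htx.2.trans_lt hxi.2⟩
    have e2 := prim_sub_prim u a x
    rw [e, intervalIntegral_volD _ (P.node_mem _) (Ioo_subset_Icc_self hxD),
      intervalIntegral.integral_eq_sub_of_hasDerivAt (f := fun t => q.eval t)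
        (fun t _ => by rw [← hqd]; exact q.hasDerivAt t)
        (p.continuous.intervalIntegrable _ _)] at e2
    linarith

theorem meanFree_mem_piecewisePoly {P : Mesh} {r : ℕ} {u : L2D} (hu : u ∈ piecewisePoly P r) :
    meanFree u ∈ piecewisePoly P r :=
  Submodule.sub_mem _ hu (Submodule.smul_mem _ _ (P.one2_mem_piecewisePoly r))

theorem green_mem_piecewisePoly {P : Mesh} {r : ℕ} {u : L2D} (hu : u ∈ piecewisePoly P r) :
    green u ∈ piecewisePoly P (r + 2) :=
  Submodule.neg_mem _ (volterra_mem_piecewisePoly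
    (meanFree_mem_piecewisePoly (volterra_mem_piecewisePoly hu)))

theorem green_mem_splineSpace_two {P : Mesh} {s : L2D} (hs : s ∈ piecewisePoly P 0) :
    green s ∈ splineSpace P 2 2 :=
  ⟨mem_sobolev_two_iff_green.mpr ⟨s, rfl⟩, green_mem_piecewisePoly hs⟩

/-- With `green_mem_splineSpace_two`, this supplies the elements that every admissible `M` must
contain: second derivatives may be piecewise constant for `r = 2`, and primitives of piecewise
constants for `r = 3`. -/
theorem green_volterra_mem_splineSpace_three {P : Mesh} {s : L2D} (hs : s ∈ piecewisePoly P 0) :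
    green (volterra s) ∈ splineSpace P 3 3 := by
  have h := mem_sobolev_two_iff_green.mpr ⟨volterra s, rfl⟩
  refine ⟨⟨fun l hl => ?_, h.2⟩, green_mem_piecewisePoly (volterra_mem_piecewisePoly hs)⟩
  rcases hl.eq_or_lt with rfl | hl
  · exact ⟨_, hasWeakDeriv_three_green _ (hasWeakDeriv_volterra s)⟩
  · exact h.1 l (Nat.le_of_lt_succ hl)

theorem norm_sq_L2D (u : L2D) : ‖u‖ ^ 2 = ∫ x, u x ^ 2 ∂volD := by
  rw [← real_inner_self_eq_norm_sq, inner_L2D]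
  simp only [sq]

theorem integrable_sq_L2D (u : L2D) : Integrable (fun x => u x ^ 2) volD :=
  (Lp.memLp u).integrable_sq

/-- On each element `s` is the value of the primitive at the left node. Cauchy–Schwarz bounds the
squared difference there by `h ∫ g²`, and integrating over the element gives another factor `h`. -/
theorem exists_piecewiseConst_norm_volterra_sub_le (P : Mesh) (g : L2D) :
    ∃ s ∈ piecewisePoly P 0, ‖volterra g - s‖ ≤ P.size * ‖g‖ := by
  let c : Fin P.N → Fin 1 → ℝ := fun i _ => prim g (P.node i.castSucc)
  refine ⟨P.ppMap 1 c, P.ppMap_one_mem c, ?_⟩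
  set e := volterra g - P.ppMap 1 c with he
  have hpt : ∀ᵐ x ∂volD, ∀ i, x ∈ P.elem i → e x = ∫ t in P.node i.castSucc..x, g t ∂volD := by
    filter_upwards [Lp.coeFn_sub (volterra g) (P.ppMap 1 c), coeFn_toL2 (prim g),
      P.coeFn_ppMap 1 c] with x h1 h2 h3 i hi
    rw [he, h1, Pi.sub_apply, volterra_apply, h2, h3, P.ppFun_of_mem c hi, ← prim_sub_prim]
    simp [c]
  have hel : ∀ i : Fin P.N, ∫ x in P.node i.castSucc..P.node i.succ, e x ^ 2 ∂volD ≤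
      P.size ^ 2 * ∫ x in P.node i.castSucc..P.node i.succ, g x ^ 2 ∂volD := by
    intro i
    set a := P.node i.castSucc
    set b := P.node i.succ
    have hab : a < b := P.node_lt i
    have hsz : b - a ≤ P.size := P.size_ge i
    set G := ∫ x in a..b, g x ^ 2 ∂volD with hG
    have hG0 : 0 ≤ G := intervalIntegral.integral_nonneg hab.le fun x _ => sq_nonneg _
    have hb : ∀ᵐ x, x ∈ uIoc a b → ‖e x ^ 2‖ ≤ P.size * G := by
      rw [ae_restrict_iff' measurableSet_Ioo] at hpt
      have hne : ∀ᵐ x : ℝ, x ≠ b := by simp [ae_iff]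
      filter_upwards [hpt, hne] with x hx hxb hxI
      rw [uIoc_of_le hab.le] at hxI
      have hxi : x ∈ P.elem i := ⟨hxI.1, hxI.2.lt_of_ne hxb⟩
      have hxD := P.elem_subset i hxi
      have hxc := Ioo_subset_Icc_self hxD
      rw [hx hxD i hxi, Real.norm_of_nonneg (sq_nonneg _),
        intervalIntegral_volD _ (P.node_mem _) hxc]
      have hsub : uIcc a x ⊆ uIcc 0 1 := by
        rw [uIcc_of_le hxI.1.le, uIcc_of_le zero_le_one]
        exact Icc_subset_Icc (P.node_mem _).1 hxc.2
      have h2 : IntervalIntegrable (fun x => g x ^ 2) volume 0 1 := by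
        rw [intervalIntegrable_iff_integrableOn_Ioo_of_le zero_le_one]
        exact integrable_sq_L2D g
      refine (sq_intervalIntegral_le hxI.1.le ((intervalIntegrable_L2D g).mono_set hsub)
        (h2.mono_set hsub)).trans ?_
      rw [← intervalIntegral_volD _ (P.node_mem _) hxc]
      have hi := integrable_sq_L2D g
      have hle : ∫ t in a..x, g t ^ 2 ∂volD ≤ G := by
        rw [hG, ← intervalIntegral.integral_add_adjacent_intervals (a := a) (b := x) (c := b)
          hi.intervalIntegrable hi.intervalIntegrable]
        linarith [intervalIntegral.integral_nonneg (μ := volD) hxI.2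
          (fun t _ => sq_nonneg (g t))]
      have h0 : 0 ≤ ∫ t in a..x, g t ^ 2 ∂volD :=
        intervalIntegral.integral_nonneg hxI.1.le fun x _ => sq_nonneg _
      exact mul_le_mul (by linarith [hxI.2]) hle h0 P.size_nonneg
    have h1 := intervalIntegral.norm_integral_le_of_norm_le_const_ae hb
    rw [← intervalIntegral_volD _ (P.node_mem _) (P.node_mem _), abs_of_pos (sub_pos.mpr hab)] at h1
    refine (le_abs_self _).trans (h1.trans ?_)
    rw [sq, mul_assoc, mul_assoc]
    refine mul_le_mul_of_nonneg_left ?_ P.size_nonneg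
    rw [mul_comm]
    exact mul_le_mul_of_nonneg_right hsz hG0
  -- The element bounds are added by induction along the nodes; the last node is `1`.
  have hsum : ∀ j, ∫ x in (0 : ℝ)..P.node j, e x ^ 2 ∂volD ≤
      P.size ^ 2 * ∫ x in (0 : ℝ)..P.node j, g x ^ 2 ∂volD := by
    intro j
    induction j using Fin.induction with
    | zero => simp [P.node_first]
    | succ i ih =>
      rw [← intervalIntegral.integral_add_adjacent_intervals (b := P.node i.castSucc)
          (integrable_sq_L2D e).intervalIntegrable (integrable_sq_L2D e).intervalIntegrable,
        ← intervalIntegral.integral_add_adjacent_intervals (b := P.node i.castSucc)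
          (integrable_sq_L2D g).intervalIntegrable (integrable_sq_L2D g).intervalIntegrable, mul_add]
      exact add_le_add ih (hel i)
  have h := hsum (Fin.last P.N)
  rw [P.node_last, intervalIntegral_volD _ (by simp) (by simp),
    intervalIntegral_volD _ (by simp) (by simp), ← integral_volD, ← integral_volD,
    ← norm_sq_L2D, ← norm_sq_L2D, ← mul_pow] at h
  exact (sq_le_sq₀ (norm_nonneg _) (mul_nonneg P.size_nonneg (norm_nonneg _))).mp h

/-! ### Coercivity and the continuous problem -/

section Hilbert

variable {H : Type*} [NormedAddCommGroup H] [InnerProductSpace ℝ H]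

/-- **Lax–Milgram** on a complete subspace. -/
theorem exists_mem_forall_inner_eq (V : Submodule ℝ H) [CompleteSpace V] (T : H →L[ℝ] H)
    {c : ℝ} (hc : 0 < c) (hT : ∀ a, c * ‖a‖ ^ 2 ≤ ⟪T a, a⟫_ℝ) (l : H →L[ℝ] ℝ) :
    ∃ a ∈ V, ∀ b ∈ V, ⟪T a, b⟫_ℝ = l b := by
  let B : V →L[ℝ] V →L[ℝ] ℝ := LinearMap.mkContinuous₂
    (LinearMap.mk₂ ℝ (fun a b : V => ⟪T a, (b : H)⟫_ℝ)
      (fun a a' b => by simp [inner_add_left]) (fun r a b => by simp [real_inner_smul_left])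
      (fun a b b' => by simp [inner_add_right]) (fun r a b => by simp [real_inner_smul_right]))
    ‖T‖ fun a b => (norm_inner_le_norm _ _).trans
      (mul_le_mul_of_nonneg_right (T.le_opNorm _) (norm_nonneg _))
  have hB : ∀ a b : V, B a b = ⟪T a, (b : H)⟫_ℝ := fun _ _ => rfl
  have hco : IsCoercive B := ⟨c, hc, fun a => by
    rw [hB, mul_assoc, ← sq]
    exact hT a⟩
  let l' : V := (InnerProductSpace.toDual ℝ V).symm (l.comp V.subtypeL)
  obtain ⟨a, ha⟩ := hco.continuousLinearEquivOfBilin.surjective l'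
  refine ⟨a, a.2, fun b hb => ?_⟩
  have e := hco.continuousLinearEquivOfBilin_apply a ⟨b, hb⟩
  rw [ha, hB] at e
  rw [← e]
  simp [l']

theorem eq_zero_of_coercive {T : H →L[ℝ] H} {c : ℝ} (hc : 0 < c)
    (hT : ∀ a, c * ‖a‖ ^ 2 ≤ ⟪T a, a⟫_ℝ) {a : H} (h : ⟪T a, a⟫_ℝ = 0) : a = 0 := by
  have h1 := hT a
  rw [h] at h1
  have h2 : ‖a‖ ^ 2 = 0 := le_antisymm (by nlinarith) (sq_nonneg _)
  simpa using h2

end Hilbert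

/-- The operator `1 - μ A + μ² A²`. -/
def symbolOp (μ : ℝ) : L2D →L[ℝ] L2D :=
  ContinuousLinearMap.id ℝ L2D - μ • green + μ ^ 2 • (green ∘L green)

variable {μ : ℝ}

theorem symbolOp_apply (u : L2D) :
    symbolOp μ u = u - μ • green u + μ ^ 2 • green (green u) := rfl

theorem symbolOp_green (u : L2D) : symbolOp μ (green u) = green (symbolOp μ u) := by
  simp [symbolOp_apply]

theorem inner_symbolOp_comm (u v : L2D) : ⟪symbolOp μ u, v⟫_ℝ = ⟪u, symbolOp μ v⟫_ℝ := by
  simp only [symbolOp_apply, inner_add_left, inner_sub_left, inner_add_right, inner_sub_right,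
    real_inner_smul_left, real_inner_smul_right, inner_green_comm]

/-- Half of `‖u - μAu‖² ≥ 0` absorbs the indefinite term `-μ(Au, u)` at the cost of half of `‖u‖²`
and half of `μ²‖Au‖²`. -/
theorem symbolOp_coercive (u : L2D) : 1 / 2 * ‖u‖ ^ 2 ≤ ⟪symbolOp μ u, u⟫_ℝ := by
  have e : ⟪symbolOp μ u, u⟫_ℝ = ‖u‖ ^ 2 - μ * ⟪green u, u⟫_ℝ + μ ^ 2 * ‖green u‖ ^ 2 := by
    simp only [symbolOp_apply, inner_add_left, inner_sub_left, real_inner_smul_left,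
      real_inner_self_eq_norm_sq, inner_green_comm (green u) u]
  have h := sq_nonneg ‖u - μ • green u‖
  have e2 := norm_sub_sq_real u (μ • green u)
  rw [norm_smul, mul_pow, Real.norm_eq_abs, sq_abs, real_inner_smul_right,
    real_inner_comm] at e2
  have h3 := mul_nonneg (sq_nonneg μ) (sq_nonneg ‖green u‖)
  rw [e]
  linarith

/-- The same completion of the square one level down: pairing with `Au` turns every inner product
into one of `gradOp` images. -/
theorem inner_symbolOp_green_ge (u : L2D) :
    1 / 2 * ‖gradOp u‖ ^ 2 ≤ ⟪symbolOp μ u, green u⟫_ℝ := by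
  have e : ⟪symbolOp μ u, green u⟫_ℝ = ‖gradOp u‖ ^ 2 - μ * ⟪gradOp u, gradOp (green u)⟫_ℝ
      + μ ^ 2 * ‖gradOp (green u)‖ ^ 2 := by
    simp only [symbolOp_apply, inner_add_left, inner_sub_left, real_inner_smul_left]
    rw [← inner_green_comm u u, inner_green, inner_green, inner_green,
      real_inner_self_eq_norm_sq, real_inner_self_eq_norm_sq]
  have h := sq_nonneg ‖gradOp u - μ • gradOp (green u)‖
  have e2 := norm_sub_sq_real (gradOp u) (μ • gradOp (green u))
  rw [norm_smul, mul_pow, Real.norm_eq_abs, sq_abs, real_inner_smul_right] at e2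
  have h3 := mul_nonneg (sq_nonneg μ) (sq_nonneg ‖gradOp (green u)‖)
  rw [e]
  linarith

theorem symbolOp_surjective (f : L2D) : ∃ y, symbolOp μ y = f := by
  have : CompleteSpace (⊤ : Submodule ℝ L2D) := isClosed_univ.isComplete.completeSpace_coe
  obtain ⟨y, -, hy⟩ := exists_mem_forall_inner_eq (⊤ : Submodule ℝ L2D) (symbolOp μ)
    one_half_pos symbolOp_coercive (innerSL ℝ f)
  exact ⟨y, ext_inner_right ℝ fun b => hy b trivial⟩

theorem symbolOp_injective : Function.Injective (symbolOp μ) := by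
  rw [injective_iff_map_eq_zero]
  intro u hu
  exact eq_zero_of_coercive one_half_pos (symbolOp_coercive (μ := μ)) (by rw [hu, inner_zero_left])

theorem norm_le_two_mul_norm_symbolOp (u : L2D) : ‖u‖ ≤ 2 * ‖symbolOp μ u‖ := by
  have h := (symbolOp_coercive (μ := μ) u).trans (real_inner_le_norm _ _)
  rcases (norm_nonneg u).eq_or_lt with h0 | h0
  · rw [← h0]
    positivity
  · nlinarith

/-- With `y = ∂⁴v` one has `v = A²y` and `∂²v = -Ay`, so the differential equation reads `S y = f`.
-/
theorem isSolution_iff {f v : L2D} :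
    IsSolution μ f v ↔ ∃ y, symbolOp μ y = f ∧ v = green (green y) := by
  have key : ∀ y, weakDeriv 4 (green (green y)) + μ • weakDeriv 2 (green (green y))
      + μ ^ 2 • green (green y) = symbolOp μ y := by
    intro y
    rw [(hasWeakDeriv_two_green_green y).weakDeriv_eq,
      (hasWeakDeriv_two_green (green y)).weakDeriv_eq, symbolOp_apply, smul_neg, sub_eq_add_neg]
  constructor
  · rintro ⟨h1, h2, h3⟩
    obtain ⟨y, hy⟩ := h1 4 le_rfl
    have e := eq_green_green_of_mem_dotH_four h1 h2 hy
    exact ⟨y, by rw [← key, ← e, h3], e⟩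
  · rintro ⟨y, rfl, rfl⟩
    refine ⟨fun l hl => ?_, green_green_mem_dotH_four y, key y⟩
    interval_cases l
    exacts [⟨_, hasWeakDeriv_zero_order _⟩, ⟨_, hasWeakDeriv_one_green _⟩,
      ⟨_, hasWeakDeriv_two_green _⟩, ⟨_, hasWeakDeriv_three_green _ (hasWeakDeriv_one_green y)⟩,
      ⟨_, hasWeakDeriv_two_green_green y⟩]

theorem existsUnique_isSolution (f : L2D) : ∃! v, IsSolution μ f v := by
  obtain ⟨y, hy⟩ := symbolOp_surjective (μ := μ) f
  refine ⟨green (green y), isSolution_iff.mpr ⟨y, hy, rfl⟩, fun v hv => ?_⟩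
  obtain ⟨y', hy', rfl⟩ := isSolution_iff.mp hv
  rw [symbolOp_injective (hy'.trans hy.symm)]

/-! ### The Galerkin method: existence, Céa, duality, approximation -/

section FiniteElement

variable {P : Mesh} {r : ℕ} {M : Submodule ℝ L2D}

theorem IsFESpace.exists_green_eq (hM : IsFESpace P r M) {u : L2D} (hu : u ∈ M) :
    ∃ w, u = green w := by
  obtain ⟨⟨h1, h2⟩, -⟩ := hM.2 hu
  obtain ⟨w, hw⟩ := mem_sobolev_two_iff_green.mp ⟨h1, h2⟩
  exact ⟨w, hw.symm⟩

theorem IsFESpace.finiteDimensional (hM : IsFESpace P r M) : FiniteDimensional ℝ M :=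
  Submodule.finiteDimensional_of_le (hM.2.trans inf_le_right)

/-- The negative second derivatives of the elements of `M`. -/
abbrev secondDerivs (M : Submodule ℝ L2D) : Submodule ℝ L2D :=
  M.comap (green : L2D →ₗ[ℝ] L2D)

theorem IsFESpace.completeSpace (hM : IsFESpace P r M) : CompleteSpace (secondDerivs M) := by
  have := hM.finiteDimensional
  have hi : Function.Injective ((green : L2D →ₗ[ℝ] L2D).restrict
      (p := secondDerivs M) (q := M) fun _ h => h) := fun a b h =>
    Subtype.ext (green_injective (congrArg Subtype.val h))
  have := FiniteDimensional.of_injective _ hi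
  exact FiniteDimensional.complete ℝ _

/-- Writing `χ = A b` and moving `A` across by symmetry turns the bilinear form into `(S a, b)`,
which is coercive in `L²(D)`. -/
theorem isFESolution_green_iff (hM : IsFESpace P r M) {f a : L2D} :
    IsFESolution μ M f (green a) ↔ a ∈ secondDerivs M ∧
      ∀ b ∈ secondDerivs M, ⟪symbolOp μ a, b⟫_ℝ = ⟪green f, b⟫_ℝ := by
  have key : ∀ b, ⟪weakDeriv 2 (green a), weakDeriv 2 (green b)⟫_ℝ
      + μ * ⟪weakDeriv 2 (green a), green b⟫_ℝ + μ ^ 2 * ⟪green a, green b⟫_ℝ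
      = ⟪symbolOp μ a, b⟫_ℝ := by
    intro b
    rw [(hasWeakDeriv_two_green a).weakDeriv_eq, (hasWeakDeriv_two_green b).weakDeriv_eq]
    simp only [symbolOp_apply, inner_add_left, inner_sub_left, real_inner_smul_left,
      inner_neg_left, inner_neg_right, inner_green_comm _ b]
    ring
  constructor
  · rintro ⟨h1, h2⟩
    refine ⟨h1, fun b hb => ?_⟩
    rw [inner_green_comm f b]
    exact (key b).symm.trans (h2 (green b) hb)
  · rintro ⟨h1, h2⟩
    refine ⟨h1, fun χ hχ => ?_⟩
    obtain ⟨b, rfl⟩ := hM.exists_green_eq hχ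
    rw [key, h2 b hχ, inner_green_comm]

theorem existsUnique_isFESolution (hM : IsFESpace P r M) (f : L2D) :
    ∃! vh, IsFESolution μ M f vh := by
  have := hM.completeSpace
  obtain ⟨a, ha, hab⟩ := exists_mem_forall_inner_eq (secondDerivs M) (symbolOp μ)
    one_half_pos symbolOp_coercive (innerSL ℝ (green f))
  refine ⟨green a, (isFESolution_green_iff hM).mpr ⟨ha, hab⟩, fun v hv => ?_⟩
  obtain ⟨a', rfl⟩ := hM.exists_green_eq hv.1
  obtain ⟨ha', hab'⟩ := (isFESolution_green_iff hM).mp hv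
  have hm := Submodule.sub_mem _ ha' ha
  have h0 : ⟪symbolOp μ (a' - a), a' - a⟫_ℝ = 0 := by
    rw [map_sub, inner_sub_left, hab' _ hm, hab _ hm]
    exact sub_self _
  rw [sub_eq_zero.mp (eq_zero_of_coercive one_half_pos symbolOp_coercive h0)]

/-- Céa's lemma: orthogonality replaces `e` by `a - b` in the second slot of `(S e, e)`. The factor
`2` is the inverse of the coercivity constant. -/
theorem norm_le_of_galerkin {V : Submodule ℝ L2D} {e a a' b : L2D} (he : e = a - a')
    (ha' : a' ∈ V) (hb : b ∈ V) (ho : ∀ b ∈ V, ⟪symbolOp μ e, b⟫_ℝ = 0) :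
    ‖e‖ ≤ 2 * ‖symbolOp μ‖ * ‖a - b‖ := by
  have h1 : ⟪symbolOp μ e, e⟫_ℝ = ⟪symbolOp μ e, a - b⟫_ℝ := by
    have h2 := ho _ (V.sub_mem hb ha')
    have h3 : e = (a - b) + (b - a') := by rw [he]; abel
    calc ⟪symbolOp μ e, e⟫_ℝ = ⟪symbolOp μ e, (a - b) + (b - a')⟫_ℝ := by rw [← h3]
      _ = _ := by rw [inner_add_right, h2, add_zero]
  have h2 := symbolOp_coercive (μ := μ) e
  have h3 : ⟪symbolOp μ e, a - b⟫_ℝ ≤ ‖symbolOp μ‖ * ‖e‖ * ‖a - b‖ :=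
    (real_inner_le_norm _ _).trans
      (mul_le_mul_of_nonneg_right ((symbolOp μ).le_opNorm e) (norm_nonneg _))
  rcases (norm_nonneg e).eq_or_lt with h0 | h0
  · rw [← h0]
    positivity
  · nlinarith

/-- The **Aubin–Nitsche** duality argument. -/
theorem norm_green_le_of_galerkin {V : Submodule ℝ L2D} {e : L2D} {δ : ℝ}
    (ho : ∀ b ∈ V, ⟪symbolOp μ e, b⟫_ℝ = 0)
    (happ : ∀ y, ∃ b ∈ V, ‖green y - b‖ ≤ δ * ‖y‖) :
    ‖green e‖ ≤ 2 * ‖symbolOp μ‖ * δ * ‖e‖ := by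
  -- The dual problem `S y = A e`: as `S` is symmetric and commutes with `A`, `‖A e‖² = (S e, A y)`,
  -- from which any `b ∈ V` may be subtracted.
  obtain ⟨y, hy⟩ := symbolOp_surjective (μ := μ) (green e)
  obtain ⟨b, hb, hyb⟩ := happ y
  have hyn := norm_le_two_mul_norm_symbolOp (μ := μ) y
  rw [hy] at hyn
  have h1 : ‖green e‖ ^ 2 = ⟪symbolOp μ e, green y - b⟫_ℝ := by
    rw [inner_sub_right, ho b hb, sub_zero, inner_symbolOp_comm, symbolOp_green, hy,
      ← inner_green_comm, real_inner_self_eq_norm_sq]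
  have h2 : ‖green e‖ ^ 2 ≤ ‖symbolOp μ‖ * ‖e‖ * (δ * ‖y‖) := by
    rw [h1]
    exact (real_inner_le_norm _ _).trans (mul_le_mul ((symbolOp μ).le_opNorm e) hyb
      (norm_nonneg _) (by positivity))
  have hδy : 0 ≤ δ * ‖y‖ := (norm_nonneg _).trans hyb
  -- The sign of `δ` is not assumed. It follows from `hyb` when `y ≠ 0`; when `y = 0`, injectivity
  -- of `A` gives `e = 0`.
  rcases (norm_nonneg (green e)).eq_or_lt with h0 | h0
  · rcases (norm_nonneg y).eq_or_lt with hy0 | hy0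
    · rw [← h0]
      have hδ : y = 0 := norm_eq_zero.mp hy0.symm
      have he : e = 0 := green_injective (by rw [← hy, hδ, map_zero, map_zero])
      simp [he]
    · have hδ : 0 ≤ δ := nonneg_of_mul_nonneg_left hδy hy0
      rw [← h0]
      positivity
  · have hy0 : 0 < ‖y‖ := by
      refine (norm_nonneg y).lt_of_ne fun h => h0.ne' ?_
      rw [← hy, norm_eq_zero.mp h.symm, map_zero, norm_zero]
    have hδ : 0 ≤ δ := nonneg_of_mul_nonneg_left hδy hy0
    have h3 : ‖symbolOp μ‖ * ‖e‖ * (δ * ‖y‖) ≤ ‖symbolOp μ‖ * ‖e‖ * (δ * (2 * ‖green e‖)) := by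
      gcongr
    have h4 : ‖green e‖ * ‖green e‖ ≤ (2 * ‖symbolOp μ‖ * δ * ‖e‖) * ‖green e‖ := by
      nlinarith
    exact le_of_mul_le_mul_right h4 h0

theorem exists_approx_of_eq_two (hM : IsFESpace P 2 M) (y : L2D) :
    ∃ b ∈ secondDerivs M, ‖green y - b‖ ≤ P.size * ‖gradOp y‖ := by
  obtain ⟨s, hs, h⟩ := exists_piecewiseConst_norm_volterra_sub_le P (-gradOp y)
  refine ⟨s, hM.1 (green_mem_splineSpace_two hs), ?_⟩
  rwa [map_neg, norm_neg] at h

/-- With `p` the `L²` projection of `gradOp y` onto piecewise constants and `w = gradOp y - p`, the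
error of `volterra (-p)` is `volterra w`. Orthogonality of `w` to piecewise constants gains one `h`;
the bounds `‖w‖ ≤ ‖gradOp y‖` and `‖w‖ ≤ h‖y‖` give the two estimates. -/
theorem exists_approx_of_eq_three (hM : IsFESpace P 3 M) (y : L2D) :
    ∃ b ∈ secondDerivs M, ‖green y - b‖ ≤ P.size * ‖gradOp y‖ ∧
      ‖green y - b‖ ≤ P.size ^ 2 * ‖y‖ := by
  set K := piecewisePoly P 0
  set p := K.starProjection (gradOp y)
  set w := gradOp y - p with hw
  have hp : p ∈ K := K.starProjection_apply_mem _
  have ho : ∀ s ∈ K, ⟪w, s⟫_ℝ = 0 := fun s hs => K.starProjection_inner_eq_zero _ s hs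
  have hmin : ∀ s ∈ K, ‖w‖ ≤ ‖gradOp y - s‖ := by
    intro s hs
    have h1 : ⟪w, p - s⟫_ℝ = 0 := ho _ (K.sub_mem hp hs)
    have h2 : gradOp y - s = w + (p - s) := by rw [hw]; abel
    have h3 := norm_add_sq_real w (p - s)
    rw [h1, ← h2] at h3
    refine (sq_le_sq₀ (norm_nonneg _) (norm_nonneg _)).mp ?_
    nlinarith [sq_nonneg ‖p - s‖]
  -- As `w` has mean zero, `‖volterra w‖² = -(w, volterra (volterra w))`. A piecewise constant
  -- approximation may be subtracted in the second slot, leaving at most `‖w‖ · h‖volterra w‖`.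
  have hJ : ‖volterra w‖ ≤ P.size * ‖w‖ := by
    obtain ⟨s, hs, h⟩ := exists_piecewiseConst_norm_volterra_sub_le P (volterra w)
    have h1 := inner_volterra_add w (volterra w)
    rw [real_inner_comm w one2, ho _ (P.one2_mem_piecewisePoly 0), zero_mul,
      real_inner_self_eq_norm_sq] at h1
    have h2 : ⟪w, volterra (volterra w)⟫_ℝ = ⟪w, volterra (volterra w) - s⟫_ℝ := by
      rw [inner_sub_right, ho s hs, sub_zero]
    have h3 := (neg_le_abs _).trans (abs_real_inner_le_norm w (volterra (volterra w) - s))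
    have h4 := mul_le_mul_of_nonneg_left h (norm_nonneg w)
    have hs0 := mul_nonneg P.size_nonneg (norm_nonneg w)
    rcases (norm_nonneg (volterra w)).eq_or_lt with h0 | h0
    · rw [← h0]
      exact hs0
    · rw [h2] at h1
      nlinarith
  have hw1 : ‖w‖ ≤ ‖gradOp y‖ := by simpa using hmin 0 K.zero_mem
  have hw2 : ‖w‖ ≤ P.size * ‖y‖ := by
    obtain ⟨s, hs, h⟩ := exists_piecewiseConst_norm_volterra_sub_le P y
    -- `gradOp y` is `volterra y` minus its mean, so the approximation of `volterra y` is shifted by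
    -- the same constant.
    refine (hmin (s - ⟪one2, volterra y⟫_ℝ • one2)
      (K.sub_mem hs (K.smul_mem _ (P.one2_mem_piecewisePoly 0)))).trans ?_
    rwa [gradOp_apply, meanFree_apply, sub_sub_sub_cancel_right]
  have e : green y - volterra (-p) = -volterra w := by
    rw [green_apply, hw, map_sub, map_neg]
    abel
  refine ⟨volterra (-p), hM.1 (green_volterra_mem_splineSpace_three (K.neg_mem hp)), ?_, ?_⟩
  · rw [e, norm_neg]
    exact hJ.trans (mul_le_mul_of_nonneg_left hw1 P.size_nonneg)
  · rw [e, norm_neg, sq, mul_assoc]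
    exact hJ.trans (mul_le_mul_of_nonneg_left hw2 P.size_nonneg)

end FiniteElement

/-! ### The negative norm -/

theorem norm_le_sobolevNorm (m : ℕ) (u : L2D) : ‖u‖ ≤ sobolevNorm m u := by
  refine Real.le_sqrt_of_sq_le ?_
  have h := Finset.single_le_sum (f := fun l => ‖weakDeriv l u‖ ^ 2) (fun l _ => sq_nonneg _)
    (Finset.mem_range.mpr m.succ_pos)
  rwa [(hasWeakDeriv_zero_order u).weakDeriv_eq] at h

/-- The quotients are bounded above by `‖f‖`; this must be shown because the real `sSup` of an
unbounded set is `0`. -/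
theorem inner_le_negNorm_mul (f : L2D) {m : ℕ} {φ : L2D} (hφ : φ ∈ dotH m) :
    ⟪f, φ⟫_ℝ ≤ negNorm m f * sobolevNorm m φ := by
  by_cases h0 : φ = 0
  · have : sobolevNorm m φ = 0 := by
      simp [sobolevNorm, h0, (HasWeakDeriv.zero _).weakDeriv_eq]
    rw [this, h0, inner_zero_right, mul_zero]
  have hp : 0 < sobolevNorm m φ := (norm_pos_iff.mpr h0).trans_le (norm_le_sobolevNorm m φ)
  rw [← div_le_iff₀ hp]
  refine le_csSup ⟨‖f‖, ?_⟩ ⟨φ, hφ, h0, rfl⟩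
  rintro t ⟨ψ, -, hψ, rfl⟩
  have hp : 0 < sobolevNorm m ψ := (norm_pos_iff.mpr hψ).trans_le (norm_le_sobolevNorm m ψ)
  rw [div_le_iff₀ hp]
  exact (real_inner_le_norm _ _).trans
    (mul_le_mul_of_nonneg_left (norm_le_sobolevNorm m ψ) (norm_nonneg _))

theorem negNorm_one_nonneg (f : L2D) : 0 ≤ negNorm 1 f := by
  have h1 := inner_le_negNorm_mul f (green_mem_dotH_one one2)
  have h2 := inner_le_negNorm_mul f (green_mem_dotH_one (-one2))
  rw [map_neg, inner_neg_right] at h2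
  have hne : green one2 ≠ 0 := by
    intro h
    have : one2 = 0 := green_injective (by rw [h, map_zero])
    have h3 := norm_one2
    rw [this, norm_zero] at h3
    exact zero_ne_one h3
  have h3 := norm_pos_iff.mpr hne
  have h4 := norm_le_sobolevNorm 1 (green one2)
  have h5 := norm_le_sobolevNorm 1 (-green one2)
  rw [norm_neg] at h5
  by_contra! hneg
  nlinarith

theorem sobolevNorm_green_le (y : L2D) :
    sobolevNorm 1 (green y) ≤ (‖volterra‖ + 1) * ‖gradOp y‖ := by
  have h : ‖green y‖ ≤ ‖volterra‖ * ‖gradOp y‖ := by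
    rw [green_apply, norm_neg]
    exact volterra.le_opNorm _
  refine Real.sqrt_le_iff.mpr ⟨by positivity, ?_⟩
  rw [Finset.sum_range_succ, Finset.sum_range_one, (hasWeakDeriv_zero_order _).weakDeriv_eq,
    (hasWeakDeriv_one_green y).weakDeriv_eq, norm_neg]
  have h2 := pow_le_pow_left₀ (norm_nonneg _) h 2
  have h3 : 0 ≤ ‖volterra‖ * ‖gradOp y‖ * ‖gradOp y‖ := by positivity
  nlinarith

/-- Testing `S y` with `Ay ∈ Ḣ¹` bounds `½‖gradOp y‖²` by the negative norm times `‖Ay‖₁`, which is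
itself at most a multiple of `‖gradOp y‖`. -/
theorem norm_gradOp_le_negNorm (y : L2D) :
    ‖gradOp y‖ ≤ 2 * (‖volterra‖ + 1) * negNorm 1 (symbolOp μ y) := by
  have h1 := inner_symbolOp_green_ge (μ := μ) y
  have h2 := inner_le_negNorm_mul (symbolOp μ y) (green_mem_dotH_one y)
  have h3 := negNorm_one_nonneg (symbolOp μ y)
  have h4 := mul_le_mul_of_nonneg_left (sobolevNorm_green_le y) h3
  rcases (norm_nonneg (gradOp y)).eq_or_lt with h0 | h0
  · rw [← h0]
    positivity
  · nlinarith

end CHC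

end

/-! ### Assembly of the error estimates -/

theorem proposition2p1 (μ : ℝ)
    (hμ : ∃ κ : ℕ, 1 ≤ κ ∧ ((κ : ℝ) - 1) ^ 2 * Real.pi ^ 2 ≤ μ ∧
      μ < (κ : ℝ) ^ 2 * Real.pi ^ 2)
    (r : ℕ) (hr : r = 2 ∨ r = 3) :
    (∀ f : CHC.L2D, ∃! v : CHC.L2D, CHC.IsSolution μ f v) ∧
    (∀ (P : CHC.Mesh) (M : Submodule ℝ CHC.L2D), CHC.IsFESpace P r M →
      ∀ f : CHC.L2D, ∃! vh : CHC.L2D, CHC.IsFESolution μ M f vh) ∧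
    ∃ C : ℝ, 0 < C ∧
      ∀ (P : CHC.Mesh) (M : Submodule ℝ CHC.L2D), CHC.IsFESpace P r M →
        ∀ f v vh : CHC.L2D, CHC.IsSolution μ f v → CHC.IsFESolution μ M f vh →
          (r = 3 → ‖v - vh‖ ≤ C * P.size ^ 4 * ‖f‖) ∧
          (r = 3 → ‖v - vh‖ ≤ C * P.size ^ 3 * CHC.negNorm 1 f) ∧
          (r = 2 → ‖v - vh‖ ≤ C * P.size ^ 2 * CHC.negNorm 1 f) := by
  refine ⟨CHC.existsUnique_isSolution, fun P M hM f => CHC.existsUnique_isFESolution hM f, ?_⟩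
  set t := ‖CHC.symbolOp μ‖ with ht
  set c := ‖CHC.volterra‖ + 1 with hc
  set d := ‖CHC.gradOp‖ with hd
  have ht0 : 0 ≤ t := norm_nonneg _
  have hc0 : 0 ≤ c := by positivity
  have hd0 : 0 ≤ d := norm_nonneg _
  -- One summand for each of the three estimates; the `1` ensures positivity.
  refine ⟨1 + 8 * t ^ 2 + 8 * t ^ 2 * c + 8 * t ^ 2 * c * d, by positivity, ?_⟩
  intro P M hM f v vh hv hvh
  obtain ⟨y, rfl, rfl⟩ := CHC.isSolution_iff.mp hv
  obtain ⟨a', rfl⟩ := hM.exists_green_eq hvh.1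
  obtain ⟨ha', hab⟩ := (CHC.isFESolution_green_iff hM).mp hvh
  set e := CHC.green y - a' with he
  -- Galerkin orthogonality: `S (Ay) = A (S y)`, the image under `A` of the right-hand side.
  have ho : ∀ b ∈ CHC.secondDerivs M, inner ℝ (CHC.symbolOp μ e) b = 0 := by
    intro b hb
    rw [he, map_sub, inner_sub_left, hab b hb, CHC.symbolOp_green, sub_self]
  have hcea : ∀ b ∈ CHC.secondDerivs M, ‖e‖ ≤ 2 * t * ‖CHC.green y - b‖ := fun b hb =>
    CHC.norm_le_of_galerkin he ha' hb ho
  rw [← map_sub, ← he]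
  have hh := P.size_nonneg
  have hy := CHC.norm_le_two_mul_norm_symbolOp (μ := μ) y
  have hDy := CHC.norm_gradOp_le_negNorm (μ := μ) y
  have hn := CHC.negNorm_one_nonneg (CHC.symbolOp μ y)
  rw [← hc] at hDy
  have hfin : ∀ {δ ρ s K k : ℝ}, 0 ≤ δ → ‖CHC.green e‖ ≤ 2 * t * δ * ‖e‖ →
      ‖e‖ ≤ 2 * t * ρ → 2 * t * δ * (2 * t * ρ) ≤ K * s → K ≤ k → 0 ≤ s →
      ‖CHC.green e‖ ≤ k * s := by
    intro δ ρ s K k hδ h1 h2 h3 h4 h5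
    exact h1.trans ((mul_le_mul_of_nonneg_left h2 (by positivity)).trans
      (h3.trans (mul_le_mul_of_nonneg_right h4 h5)))
  have p1 : 0 ≤ 8 * t ^ 2 := by positivity
  have p2 : 0 ≤ 8 * t ^ 2 * c := by positivity
  have p3 : 0 ≤ 8 * t ^ 2 * c * d := by positivity
  refine ⟨?_, ?_, ?_⟩
  · rintro rfl
    obtain ⟨b, hb, -, h2⟩ := CHC.exists_approx_of_eq_three hM y
    have hN := CHC.norm_green_le_of_galerkin ho fun z =>
      (CHC.exists_approx_of_eq_three hM z).imp fun b hb => ⟨hb.1, hb.2.2⟩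
    have h5 := (hcea b hb).trans (mul_le_mul_of_nonneg_left h2 (by positivity))
    rw [mul_assoc]
    refine hfin (K := 8 * t ^ 2) (by positivity) hN h5 ?_ (by linarith) (by positivity)
    calc 2 * t * P.size ^ 2 * (2 * t * (P.size ^ 2 * ‖y‖))
        = 4 * t ^ 2 * P.size ^ 4 * ‖y‖ := by ring
      _ ≤ 4 * t ^ 2 * P.size ^ 4 * (2 * ‖CHC.symbolOp μ y‖) := by gcongr
      _ = _ := by ring
  · rintro rfl
    obtain ⟨b, hb, h2, -⟩ := CHC.exists_approx_of_eq_three hM y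
    have hN := CHC.norm_green_le_of_galerkin ho fun z =>
      (CHC.exists_approx_of_eq_three hM z).imp fun b hb => ⟨hb.1, hb.2.2⟩
    have h5 := (hcea b hb).trans (mul_le_mul_of_nonneg_left h2 (by positivity))
    rw [mul_assoc]
    refine hfin (K := 8 * t ^ 2 * c) (by positivity) hN h5 ?_ (by linarith) (by positivity)
    calc 2 * t * P.size ^ 2 * (2 * t * (P.size * ‖CHC.gradOp y‖))
        = 4 * t ^ 2 * P.size ^ 3 * ‖CHC.gradOp y‖ := by ring
      _ ≤ 4 * t ^ 2 * P.size ^ 3 * (2 * c * CHC.negNorm 1 (CHC.symbolOp μ y)) := by gcongr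
      _ = _ := by ring
  · rintro rfl
    obtain ⟨b, hb, h2⟩ := CHC.exists_approx_of_eq_two hM y
    -- Only first order is available for `r = 2`, so the dual approximation rate is `h‖gradOp‖`.
    have hN := CHC.norm_green_le_of_galerkin (δ := P.size * d) ho fun z =>
      (CHC.exists_approx_of_eq_two hM z).imp fun b hb => ⟨hb.1, hb.2.trans (by
        rw [mul_assoc]
        exact mul_le_mul_of_nonneg_left (CHC.gradOp.le_opNorm z) hh)⟩
    have h5 := (hcea b hb).trans (mul_le_mul_of_nonneg_left h2 (by positivity))
    rw [mul_assoc]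
    refine hfin (K := 8 * t ^ 2 * c * d) (by positivity) hN h5 ?_ (by linarith) (by positivity)
    calc 2 * t * (P.size * d) * (2 * t * (P.size * ‖CHC.gradOp y‖))
        = 4 * t ^ 2 * d * P.size ^ 2 * ‖CHC.gradOp y‖ := by ring
      _ ≤ 4 * t ^ 2 * d * P.size ^ 2 * (2 * c * CHC.negNorm 1 (CHC.symbolOp μ y)) := by gcongr
      _ = _ := by ring
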